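/- Let $(M,g)$ be a spacetime of dimension $n+1\ge 2$, that is, a (Hausdorff, paracompact) $C^4$ manifold with a time-oriented Lorentzian metric $g$ of class $C^3$ and signature $(-,+,\dots,+)$, with Levi-Civita connection $\nabla$. Let $H\subset M$ be a compact connected horizon, that is, a compact connected $C^3$ embedded hypersurface (without boundary) which is null (the induced metric $g_T$ is degenerate at every point) and totally geodesic: for every future-directed lightlike $C^1$ vector field $n$ tangent to $H$ there is a 1-form $\omega$ on $H$ such that $\nabla_X n=\omega(X)\,n$ for all $X\in TH$. The surface gravity of such a field $n$ is the function $\omega(n):H\to\mathbb{R}$, so that $\nabla_n n=\omega(n)\,n$. Let $n'$ be a future-directed lightlike $C^1$ vector field tangent to $H$, with surface gravity $\kappa'$, and suppose that there is another such field $n$, with $n'=e^f n$ for a function $f:H\to\mathbb{R}$, whose surface gravity is a constant $\kappa\in\mathbb{R}$. Let $\alpha$ be a $C^1$ 1-form on $H$ such that $\alpha(n')=1$, and let $\tilde g=g_T+\alpha\otimes\alpha$. Then $\tilde g$ is positive definite, hence a Riemannian metric on $H$; the function $\kappa'$ is integrable with respect to the canonical Riemannian measure $d\tilde g$ of $\tilde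 g$; and $\kappa$ is negative, zero or positive if and only if the integral \[ \int_H \kappa'\, d\tilde g \] is, respectively, negative, zero or positive. -/

import Mathlib

open Set MeasureTheory Bundle Manifold
open scoped Manifold Topology

noncomputable section

/-- A `C^4` manifold is in particular of class `C^3`. -/
instance isManifold_three_of_four {E : Type*} [NormedAddCommGroup E] [NormedSpace ℝ E]
    {H : Type*} [TopologicalSpace H] {I : ModelWithCorners ℝ E H}
    {M : Type*} [TopologicalSpace M] [ChartedSpace H M] [IsManifold I 4 M] : IsManifold I 3 M :=
  IsManifold.of_le (n := 4) (by norm_cast)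

namespace NullHorizon

/-! ### Coordinates -/

section Coordinates

variable {m : ℕ} {M : Type*} [TopologicalSpace M] [ChartedSpace (EuclideanSpace ℝ (Fin m)) M]

/-- The components, in the preferred chart around `x₀`, of a tangent vector `v` at a point `y` of
the domain of that chart. -/
def coordVec (x₀ y : M) (v : TangentSpace (𝓡 m) y) : EuclideanSpace ℝ (Fin m) :=
  mfderiv (𝓡 m) 𝓘(ℝ, EuclideanSpace ℝ (Fin m)) (extChartAt (𝓡 m) x₀) y v

/-- The tangent vector at the point with coordinates `x`, in the preferred chart around `x₀`, whose
components in that chart are `v`. -/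
def ofCoordVec (x₀ : M) (x v : EuclideanSpace ℝ (Fin m)) :
    TangentSpace (𝓡 m) ((extChartAt (𝓡 m) x₀).symm x) :=
  mfderiv 𝓘(ℝ, EuclideanSpace ℝ (Fin m)) (𝓡 m) (extChartAt (𝓡 m) x₀).symm x v

/-- The `i`-th coordinate vector of `ℝ^m`. -/
def stdVec (i : Fin m) : EuclideanSpace ℝ (Fin m) := EuclideanSpace.single i 1

/-- The matrix `h_{ij}(x) = h(∂_i, ∂_j)` of a field `h` of bilinear forms, in the preferred chart
around `x₀`, at the point with coordinates `x`. -/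
def coeffMatrix (h : ∀ x : M, TangentSpace (𝓡 m) x →L[ℝ] TangentSpace (𝓡 m) x →L[ℝ] ℝ)
    (x₀ : M) (x : EuclideanSpace ℝ (Fin m)) : Matrix (Fin m) (Fin m) ℝ :=
  Matrix.of fun i j =>
    h ((extChartAt (𝓡 m) x₀).symm x) (ofCoordVec x₀ x (stdVec i)) (ofCoordVec x₀ x (stdVec j))

/-- The Christoffel symbols of the Levi-Civita connection,
`Γ^k_{ij} = 1/2 ∑_l h^{kl} (∂_i h_{jl} + ∂_j h_{il} - ∂_l h_{ij})`,
of a field `h` of nondegenerate symmetric bilinear forms, in the preferred chart around `x₀`, at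
the point with coordinates `x`. -/
def christoffel (h : ∀ x : M, TangentSpace (𝓡 m) x →L[ℝ] TangentSpace (𝓡 m) x →L[ℝ] ℝ)
    (x₀ : M) (x : EuclideanSpace ℝ (Fin m)) (k i j : Fin m) : ℝ :=
  (1 / 2 : ℝ) * ∑ l, (coeffMatrix h x₀ x)⁻¹ k l *
    (fderiv ℝ (fun y => coeffMatrix h x₀ y j l) x (stdVec i)
      + fderiv ℝ (fun y => coeffMatrix h x₀ y i l) x (stdVec j)
      - fderiv ℝ (fun y => coeffMatrix h x₀ y i j) x (stdVec l))

end Coordinates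

/-! ### Spacetimes -/

/-- A `C^3` Lorentzian metric, of signature `(-,+,…,+)`, with a time orientation, on a manifold of
dimension `m`. The signature condition says that each tangent space contains a timelike vector on
whose orthogonal complement the metric is positive definite. The time orientation is represented by
a continuous timelike vector field, declared to be future-directed. -/
structure Spacetime (m : ℕ) (M : Type*) [TopologicalSpace M]
    [ChartedSpace (EuclideanSpace ℝ (Fin m)) M] [IsManifold (𝓡 m) 4 M] where
  /-- the metric tensor -/
  metric (x : M) : TangentSpace (𝓡 m) x →L[ℝ] TangentSpace (𝓡 m) x →L[ℝ] ℝ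
  symm (x : M) (v w : TangentSpace (𝓡 m) x) : metric x v w = metric x w v
  signature (x : M) : ∃ v : TangentSpace (𝓡 m) x, metric x v v < 0 ∧
    ∀ w : TangentSpace (𝓡 m) x, metric x v w = 0 → w ≠ 0 → 0 < metric x w w
  contMDiff : ContMDiff (𝓡 m)
    ((𝓡 m).prod 𝓘(ℝ, EuclideanSpace ℝ (Fin m) →L[ℝ] EuclideanSpace ℝ (Fin m) →L[ℝ] ℝ)) 3
    (fun x => TotalSpace.mk' (EuclideanSpace ℝ (Fin m) →L[ℝ] EuclideanSpace ℝ (Fin m) →L[ℝ] ℝ)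
      (E := fun x : M => TangentSpace (𝓡 m) x →L[ℝ] TangentSpace (𝓡 m) x →L[ℝ] ℝ) x (metric x))
  /-- a future-directed timelike vector field -/
  timeField (x : M) : TangentSpace (𝓡 m) x
  timelike (x : M) : metric x (timeField x) (timeField x) < 0
  continuous_timeField :
    Continuous fun x => (⟨x, timeField x⟩ : TangentBundle (𝓡 m) M)

/-- A tangent vector is future-directed lightlike if it is nonzero, null, and in the same causal
cone as the time orientation. -/
def Spacetime.IsFutureLightlike {m : ℕ} {M : Type*} [TopologicalSpace M]
    [ChartedSpace (EuclideanSpace ℝ (Fin m)) M] [IsManifold (𝓡 m) 4 M] (g : Spacetime m M) {x : M}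
    (v : TangentSpace (𝓡 m) x) : Prop :=
  v ≠ 0 ∧ g.metric x v v = 0 ∧ g.metric x v (g.timeField x) < 0

/-! ### Hypersurfaces -/

section Hypersurface

variable {n : ℕ}
  {M : Type*} [TopologicalSpace M] [ChartedSpace (EuclideanSpace ℝ (Fin (n + 1))) M]
  [IsManifold (𝓡 (n + 1)) 4 M]
  {H : Type*} [TopologicalSpace H] [ChartedSpace (EuclideanSpace ℝ (Fin n)) H]

/-- The push-forward `dι(v)` of a tangent vector of `H` to the spacetime. -/
def push (ι : H → M) (p : H) (v : TangentSpace (𝓡 n) p) : TangentSpace (𝓡 (n + 1)) (ι p) :=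
  mfderiv (𝓡 n) (𝓡 (n + 1)) ι p v

/-- The covariant derivative `∇_X N` at `p`, for the Levi-Civita connection of the spacetime, of a
vector field `N` along `ι : H → M` in the direction of a vector `X` tangent to `H`. It is the vector
at `ι p` with components `X(N^k) + ∑_{i,j} Γ^k_{ij} X^i N^j` in the chart around `ι p`. -/
def covDeriv (g : Spacetime (n + 1) M) (ι : H → M) (N : ∀ q : H, TangentSpace (𝓡 (n + 1)) (ι q))
    (p : H) (X : TangentSpace (𝓡 n) p) : TangentSpace (𝓡 (n + 1)) (ι p) :=
  let x : EuclideanSpace ℝ (Fin (n + 1)) := extChartAt (𝓡 (n + 1)) (ι p) (ι p)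
  let dN : EuclideanSpace ℝ (Fin (n + 1)) :=
    mfderiv (𝓡 n) 𝓘(ℝ, EuclideanSpace ℝ (Fin (n + 1))) (fun q => coordVec (ι p) (ι q) (N q)) p X
  let c : EuclideanSpace ℝ (Fin (n + 1)) := WithLp.toLp 2 fun k =>
    dN k + ∑ i, ∑ j, christoffel g.metric (ι p) x k i j *
      coordVec (ι p) (ι p) (push ι p X) i * coordVec (ι p) (ι p) (N p) j
  mfderiv 𝓘(ℝ, EuclideanSpace ℝ (Fin (n + 1))) (𝓡 (n + 1)) (extChartAt (𝓡 (n + 1)) (ι p)).symm x c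

/-- The metric `g_T(v, w) = g(dι(v), dι(w))` induced on `H` (the transverse metric, when `H` is a null hypersurface). -/
def transverseMetric (g : Spacetime (n + 1) M) (ι : H → M) (p : H) :
    TangentSpace (𝓡 n) p →L[ℝ] TangentSpace (𝓡 n) p →L[ℝ] ℝ :=
  (ContinuousLinearMap.precomp ℝ (mfderiv (𝓡 n) (𝓡 (n + 1)) ι p)).comp
    ((g.metric (ι p)).comp (mfderiv (𝓡 n) (𝓡 (n + 1)) ι p))

variable [IsManifold (𝓡 n) 3 H]

/-- `l` is a `C^1` future-directed lightlike vector field tangent to `H`. -/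
structure IsLightlikeField (g : Spacetime (n + 1) M) (ι : H → M)
    (l : ∀ p : H, TangentSpace (𝓡 n) p) : Prop where
  contMDiff : ContMDiff (𝓡 n) (𝓡 n).tangent 1 fun p => (⟨p, l p⟩ : TangentBundle (𝓡 n) H)
  future (p : H) : g.IsFutureLightlike (push ι p (l p))

/-- `ω` is the 1-form of the tangent field `l`: one has `∇_X l = ω(X) l` for all `X` tangent
to `H`. -/
def IsConnectionForm (g : Spacetime (n + 1) M) (ι : H → M) (l : ∀ p : H, TangentSpace (𝓡 n) p)
    (ω : ∀ p : H, TangentSpace (𝓡 n) p →L[ℝ] ℝ) : Prop :=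
  ∀ (p : H) (X : TangentSpace (𝓡 n) p),
    covDeriv g ι (fun q => push ι q (l q)) p X = ω p X • push ι p (l p)

/-- `ι : H → M` is (the inclusion of) a `C^3` embedded hypersurface which is null, that is, its
induced metric is degenerate at every point, and totally geodesic, that is, `∇_X l = ω(X) l` for
every lightlike field `l` tangent to `H`, with some 1-form `ω` on `H`. -/
structure IsHorizon (g : Spacetime (n + 1) M) (ι : H → M) : Prop where
  contMDiff : ContMDiff (𝓡 n) (𝓡 (n + 1)) 3 ι
  injective_mfderiv (p : H) : Function.Injective (mfderiv (𝓡 n) (𝓡 (n + 1)) ι p)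
  isEmbedding : Topology.IsEmbedding ι
  null (p : H) : ∃ v : TangentSpace (𝓡 n) p, v ≠ 0 ∧
    ∀ w : TangentSpace (𝓡 n) p, transverseMetric g ι p v w = 0
  totallyGeodesic (l : ∀ p : H, TangentSpace (𝓡 n) p) (hl : IsLightlikeField g ι l) :
    ∃ ω : ∀ p : H, TangentSpace (𝓡 n) p →L[ℝ] ℝ, IsConnectionForm g ι l ω

open Classical in
/-- The 1-form `ω` with `∇_X l = ω(X) l` (it is unique if `l` vanishes nowhere, and it exists on a
horizon if `l` is lightlike; it is set to zero if it does not exist). -/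
def connectionForm (g : Spacetime (n + 1) M) (ι : H → M) (l : ∀ p : H, TangentSpace (𝓡 n) p) :
    ∀ p : H, TangentSpace (𝓡 n) p →L[ℝ] ℝ :=
  if h : ∃ ω : ∀ p : H, TangentSpace (𝓡 n) p →L[ℝ] ℝ, IsConnectionForm g ι l ω then h.choose
  else fun _ => 0

/-- The surface gravity `κ = ω(l)` of the tangent field `l`; thus `∇_l l = κ l`. -/
def surfaceGravity (g : Spacetime (n + 1) M) (ι : H → M) (l : ∀ p : H, TangentSpace (𝓡 n) p)
    (p : H) : ℝ :=
  connectionForm g ι l p (l p)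

/-- `α` is a `C^1` 1-form on `H`. -/
def IsC1Form (α : ∀ p : H, TangentSpace (𝓡 n) p →L[ℝ] ℝ) : Prop :=
  ContMDiff (𝓡 n) ((𝓡 n).prod 𝓘(ℝ, EuclideanSpace ℝ (Fin n) →L[ℝ] ℝ)) 1
    (fun p => TotalSpace.mk' (EuclideanSpace ℝ (Fin n) →L[ℝ] ℝ)
      (E := fun p : H => TangentSpace (𝓡 n) p →L[ℝ] ℝ) p (α p))

/-- The field of bilinear forms `g̃ = g_T + α ⊗ α`. -/
def tildeMetric (g : Spacetime (n + 1) M) (ι : H → M)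
    (α : ∀ p : H, TangentSpace (𝓡 n) p →L[ℝ] ℝ) (p : H) :
    TangentSpace (𝓡 n) p →L[ℝ] TangentSpace (𝓡 n) p →L[ℝ] ℝ :=
  transverseMetric g ι p + (α p).smulRight (α p)

end Hypersurface

/-! ### The Riemannian measure -/

section RiemannianMeasure

variable {n : ℕ} {H : Type*} [TopologicalSpace H] [ChartedSpace (EuclideanSpace ℝ (Fin n)) H]

/-- The measure `√(det h_{ij}) dx¹ ⋯ dxⁿ`, on the domain of the preferred chart around `c`. -/
def chartMeasure [MeasurableSpace H]
    (h : ∀ p : H, TangentSpace (𝓡 n) p →L[ℝ] TangentSpace (𝓡 n) p →L[ℝ] ℝ) (c : H) :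
    Measure H :=
  ((volume.restrict (extChartAt (𝓡 n) c).target).withDensity
    fun x => ENNReal.ofReal (Real.sqrt (coeffMatrix h c x).det)).map (extChartAt (𝓡 n) c).symm

variable (n H) in
/-- A σ-compact manifold is covered by the domains of countably many charts. -/
theorem exists_chart_cover [SigmaCompactSpace H] [Nonempty H] :
    ∃ c : ℕ → H, ⋃ k, (extChartAt (𝓡 n) (c k)).source = univ := by
  obtain ⟨s, hs, hu⟩ := countable_cover_nhds_of_sigmaCompact
    fun x : H => extChartAt_source_mem_nhds (I := 𝓡 n) x
  have hne : s.Nonempty := by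
    by_contra h
    rw [not_nonempty_iff_eq_empty] at h
    simp [h] at hu
    exact absurd hu.symm (univ_nonempty.ne_empty)
  obtain ⟨c, rfl⟩ := hs.exists_eq_range hne
  exact ⟨c, by simpa using hu⟩

/-- The canonical measure of a Riemannian metric `h` on `H`, which in every chart is
`√(det h_{ij}) dx¹ ⋯ dxⁿ`. It is obtained by cutting `H` into countably many disjoint pieces, each
contained in the domain of a chart; the result does not depend on the chosen pieces, by the
change of variables formula. -/
def riemannianMeasure [MeasurableSpace H] [SigmaCompactSpace H] [Nonempty H]
    (h : ∀ p : H, TangentSpace (𝓡 n) p →L[ℝ] TangentSpace (𝓡 n) p →L[ℝ] ℝ) : Measure H :=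
  Measure.sum fun k : ℕ =>
    (chartMeasure h ((exists_chart_cover n H).choose k)).restrict
      (disjointed (fun j => (extChartAt (𝓡 n) ((exists_chart_cover n H).choose j)).source) k)

end RiemannianMeasure

end NullHorizon

end

/-! Writing $n'=e^f n$ and comparing $\nabla_{n'}n'$ with $\nabla_{n'}n$ by the Leibniz rule gives
$\kappa'=n'(f)+e^f\kappa$ (`IsHorizon.surfaceGravity_exp_smul`). Here $f$ is $C^1$, since
$\alpha(n')=1$ forces $\alpha(n)=e^{-f}$. If $n'$ is divergence free for $\tilde g$, the term
$n'(f)$ integrates to zero on the compact manifold $H$. Hence $\int_H\kappa'\,d\tilde g=\kappa\int_H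
e^f\,d\tilde g$ with a positive factor, and the signs agree.

The divergence vanishes for two reasons. First, $\nabla_X n'$ is proportional to $n'$, hence
orthogonal to $TH$, so $\mathcal L_{n'}g_T=0$ (`lieDerivative_pullback_eq_zero`,
`IsHorizon.lieDerivative_coeffMatrix`). Second, put $\beta=\mathcal L_{n'}\alpha$; since
$\alpha(n')=1$ is constant, $\beta(n')=0$. Thus $\mathcal L_{n'}\tilde
g=\alpha\otimes\beta+\beta\otimes\alpha$, whose $\tilde g$-trace is $2\beta(n')=0$, because $\tilde
g(n',\cdot)=\alpha$ (`fderiv_sqrt_det_add_trace`, `IsHorizon.divergence_eq_zero`).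

Vectors tangent to $H$ are orthogonal to $n'$, so $g_T$ is nonnegative with kernel spanned by $n'$,
where $\alpha\otimes\alpha$ is positive. This makes $\tilde g$ positive definite. The divergence
theorem (`integral_dirDeriv_eq_zero`) is reduced by a partition of unity to integration by parts in
a chart; the change of variables formula makes the measure independent of the charts used. -/

noncomputable section

namespace NullHorizon

/-! ### Calculus in Euclidean spaces -/

/-- Jacobi's formula for the derivative of a determinant. -/
theorem hasFDerivAt_det {E : Type*} [NormedAddCommGroup E] [NormedSpace ℝ E] {n : ℕ}
    {A : E → Matrix (Fin n) (Fin n) ℝ} {A' : Fin n → Fin n → E →L[ℝ] ℝ} {x : E}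
    (hA : ∀ i j, HasFDerivAt (fun y => A y i j) (A' i j) x) :
    HasFDerivAt (fun y => (A y).det) (∑ i, ∑ j, (A x).adjugate j i • A' i j) x := by
  -- The determinant is multilinear in the rows, so its derivative is a sum over rows of
  -- determinants with one row replaced; Cramer's rule turns these into adjugate entries.
  let D : ContinuousMultilinearMap ℝ (fun _ : Fin n => Fin n → ℝ) ℝ :=
    { toMultilinearMap := (Matrix.detRowAlternating (R := ℝ) (n := Fin n)).toMultilinearMap
      cont := Continuous.matrix_det (A := fun B : Matrix (Fin n) (Fin n) ℝ => B) continuous_id }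
  have h : HasFDerivAt (fun y => D fun i => A y i) (∑ i,
      (D.toContinuousLinearMap (fun j => A x j) i).comp (ContinuousLinearMap.pi (A' i))) x :=
    HasFDerivAt.multilinear_comp D (x := x) (fun i => hasFDerivAt_pi.2 fun j => hA i j)
  refine HasFDerivAt.congr_fderiv h (Finset.sum_congr rfl fun i _ => ?_)
  ext w
  have : (D.toContinuousLinearMap (fun j => A x j) i) (fun j => A' i j w)
      = ((A x).updateRow i (fun j => A' i j w)).det := rfl
  rw [ContinuousLinearMap.comp_apply]
  change (D.toContinuousLinearMap (fun j => A x j) i) (fun j => A' i j w) = _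
  rw [this, ← Matrix.cramer_transpose_apply, Matrix.cramer_eq_adjugate_mulVec,
    ← Matrix.adjugate_transpose]
  simp [Matrix.mulVec, dotProduct]

set_option synthInstance.maxHeartbeats 400000 in
/-- The Lie derivative along `v` of the pull-back by `φ` of a field of bilinear forms `B` vanishes
if the covariant derivative of `dφ(v)`, for the Levi-Civita connection of `B`, is orthogonal to the
image of `dφ`. -/
theorem lieDerivative_pullback_eq_zero {E F : Type*} [NormedAddCommGroup E] [NormedSpace ℝ E]
    [NormedAddCommGroup F] [NormedSpace ℝ F] {φ : E → F} {x : E} (hφ : ContDiffAt ℝ 2 φ x)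
    {B : F → F →L[ℝ] F →L[ℝ] ℝ} (hB : DifferentiableAt ℝ B (φ x))
    (hsymm : ∀ᶠ y in 𝓝 (φ x), ∀ a b, B y a b = B y b a)
    {v : E → E} (hv : DifferentiableAt ℝ v x) (Γ : F → F → F)
    (hΓ : ∀ a b c, B (φ x) (Γ a b) c =
      (1 / 2 : ℝ) * (fderiv ℝ B (φ x) a b c + fderiv ℝ B (φ x) b a c - fderiv ℝ B (φ x) c a b))
    (hort : ∀ X Y, B (φ x) (fderiv ℝ (fun y => fderiv ℝ φ y (v y)) x X
      + Γ (fderiv ℝ φ x X) (fderiv ℝ φ x (v x))) (fderiv ℝ φ x Y) = 0) (X Y : E) :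
    fderiv ℝ (fun y => B (φ y) (fderiv ℝ φ y X) (fderiv ℝ φ y Y)) x (v x)
      + B (φ x) (fderiv ℝ φ x (fderiv ℝ v x X)) (fderiv ℝ φ x Y)
      + B (φ x) (fderiv ℝ φ x X) (fderiv ℝ φ x (fderiv ℝ v x Y)) = 0 := by
  have h1 : HasFDerivAt φ (fderiv ℝ φ x) x := (hφ.differentiableAt (by norm_num)).hasFDerivAt
  have h2 : HasFDerivAt (fderiv ℝ φ) (fderiv ℝ (fderiv ℝ φ) x) x :=
    ((hφ.fderiv_right (m := 1) (by norm_num)).differentiableAt (by norm_num)).hasFDerivAt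
  -- The orthogonality hypothesis differentiates `φ` in direction `X` first, the Lie derivative in
  -- direction `v`; symmetry of the second derivative reconciles the two.
  have hs : ∀ a b, fderiv ℝ (fderiv ℝ φ) x a b = fderiv ℝ (fderiv ℝ φ) x b a :=
    hφ.isSymmSndFDerivAt (by simp)
  have hN := h2.clm_apply hv.hasFDerivAt
  have hB1 : HasFDerivAt (fun y => B (φ y)) ((fderiv ℝ B (φ x)).comp (fderiv ℝ φ x)) x :=
    HasFDerivAt.comp (g := B) x hB.hasFDerivAt h1
  have key := (hB1.clm_apply (h2.clm_apply (hasFDerivAt_const X x))).clm_apply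
    (h2.clm_apply (hasFDerivAt_const Y x))
  have hdB : ∀ a b c, fderiv ℝ B (φ x) a b c = fderiv ℝ B (φ x) a c b := by
    intro a b c
    have e1 := (hB.hasFDerivAt.clm_apply (hasFDerivAt_const b (φ x))).clm_apply
      (hasFDerivAt_const c (φ x))
    have e2 := (hB.hasFDerivAt.clm_apply (hasFDerivAt_const c (φ x))).clm_apply
      (hasFDerivAt_const b (φ x))
    have := e1.unique (e2.congr_of_eventuallyEq (hsymm.mono fun y hy => hy b c))
    simpa using congrArg (fun f => f a) this
  have hsx := hsymm.self_of_nhds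
  -- Adding the two orthogonality relations, with `X` and `Y` exchanged, cancels the derivatives of
  -- `B` along `dφ(X)` and `dφ(Y)` and leaves exactly the one along `dφ(v)`.
  have o1 := hort X Y
  have o2 := hort Y X
  rw [hN.fderiv] at o1 o2
  have hk := key.fderiv
  rw [hk]
  simp only [map_add, hΓ, add_apply, ContinuousLinearMap.comp_apply,
    ContinuousLinearMap.flip_apply, zero_apply, map_zero, zero_add] at o1 o2 ⊢
  rw [hs X (v x)] at o1
  rw [hs Y (v x)] at o2
  rw [hsx (fderiv ℝ φ x (fderiv ℝ v x Y)), hsx (fderiv ℝ (fderiv ℝ φ) x (v x) Y)] at o2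
  have d1 := hdB (fderiv ℝ φ x X) (fderiv ℝ φ x (v x)) (fderiv ℝ φ x Y)
  have d2 := hdB (fderiv ℝ φ x Y) (fderiv ℝ φ x (v x)) (fderiv ℝ φ x X)
  have d3 := hdB (fderiv ℝ φ x (v x)) (fderiv ℝ φ x X) (fderiv ℝ φ x Y)
  linarith

/-- Let `A = h + a aᵀ`, where the Lie derivative of `h` along `v` vanishes, `h v = 0` and
`⟨a, v⟩ = 1`. Then the vector field `v` is divergence free with respect to `√(det A) dx`. -/
theorem fderiv_sqrt_det_add_trace {n : ℕ} {h : EuclideanSpace ℝ (Fin n) → Matrix (Fin n) (Fin n) ℝ}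
    {a : EuclideanSpace ℝ (Fin n) → Fin n → ℝ}
    {v : EuclideanSpace ℝ (Fin n) → EuclideanSpace ℝ (Fin n)} {x : EuclideanSpace ℝ (Fin n)}
    (hh : ∀ i j, DifferentiableAt ℝ (fun y => h y i j) x)
    (ha : ∀ i, DifferentiableAt ℝ (fun y => a y i) x) (hv : DifferentiableAt ℝ v x)
    (hsymm : ∀ i j, h x i j = h x j i) (hnull : ∀ j, ∑ i, v x i * h x i j = 0)
    (hav : ∀ᶠ y in 𝓝 x, ∑ i, a y i * v y i = 1)
    (hdet : 0 < (h x + Matrix.vecMulVec (a x) (a x)).det)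
    (hLie : ∀ i j, fderiv ℝ (fun y => h y i j) x (v x)
      + ∑ k, fderiv ℝ v x (EuclideanSpace.single i 1) k * h x k j
      + ∑ k, fderiv ℝ v x (EuclideanSpace.single j 1) k * h x i k = 0) :
    fderiv ℝ (fun y => √(h y + Matrix.vecMulVec (a y) (a y)).det) x (v x)
      + √(h x + Matrix.vecMulVec (a x) (a x)).det
        * ∑ i, fderiv ℝ v x (EuclideanSpace.single i 1) i = 0 := by
  set A : EuclideanSpace ℝ (Fin n) → Matrix (Fin n) (Fin n) ℝ :=
    fun y => h y + Matrix.vecMulVec (a y) (a y) with hAdef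
  set J : Fin n → Fin n → ℝ := fun k i => fderiv ℝ v x (EuclideanSpace.single i 1) k with hJ
  set a' : Fin n → ℝ := fun i => fderiv ℝ (fun y => a y i) x (v x) with ha'
  have hA' : ∀ i j, HasFDerivAt (fun y => A y i j) (fderiv ℝ (fun y => h y i j) x
      + (a x i • fderiv ℝ (fun y => a y j) x + a x j • fderiv ℝ (fun y => a y i) x)) x :=
    fun i j => (hh i j).hasFDerivAt.add ((ha i).hasFDerivAt.mul (ha j).hasFDerivAt)
  have hJac := (hasFDerivAt_det hA').sqrt hdet.ne'
  rw [hJac.fderiv]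
  -- the derivative of `⟨a, v⟩ = 1`
  have hvi : ∀ i, HasFDerivAt (fun y => v y i) ((EuclideanSpace.proj i).comp (fderiv ℝ v x)) x :=
    fun i => ((EuclideanSpace.proj (𝕜 := ℝ) i).hasFDerivAt).comp x hv.hasFDerivAt
  have hav0 : ∑ i, a x i * v x i = 1 := hav.self_of_nhds
  have hvsum : ∀ k, fderiv ℝ v x (v x) k = ∑ i, v x i * J k i := by
    intro k
    have hvx : v x = ∑ i, v x i • EuclideanSpace.single i (1 : ℝ) := by
      ext j; simp [Pi.single_apply]
    conv_lhs => rw [hvx]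
    simp [hJ]
  have hβ : ∑ i, (a' i * v x i) + ∑ k, ∑ i, a x k * (v x i * J k i) = 0 := by
    have h1 := HasFDerivAt.fun_sum (u := Finset.univ)
      (fun i _ => (ha i).hasFDerivAt.mul (hvi i))
    have h2 := h1.unique ((hasFDerivAt_const (1 : ℝ) x).congr_of_eventuallyEq hav)
    have h3 := congrArg (fun f => f (v x)) h2
    simp only [sum_apply, add_apply, smul_apply, ContinuousLinearMap.comp_apply,
      smul_eq_mul, zero_apply, PiLp.proj_apply, hvsum] at h3
    rw [← h3, Finset.sum_add_distrib, add_comm]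
    congr 1
    · refine Finset.sum_congr rfl fun k _ => ?_
      rw [Finset.mul_sum]
    · exact Finset.sum_congr rfl fun k _ => mul_comm _ _
  have hsA : ∀ i j, A x i j = A x j i := by
    intro i j; simp [hAdef, Matrix.vecMulVec_apply, hsymm i j, mul_comm]
  -- `A v = a`
  have hAv : ∀ j, ∑ i, v x i * A x i j = a x j := by
    intro j
    simp only [hAdef, Matrix.add_apply, Matrix.vecMulVec_apply, mul_add, Finset.sum_add_distrib,
      hnull, zero_add]
    calc ∑ i, v x i * (a x i * a x j) = (∑ i, a x i * v x i) * a x j := by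
          rw [Finset.sum_mul]
          exact Finset.sum_congr rfl fun i _ => by ring
      _ = a x j := by rw [hav0, one_mul]
  have hadj : ∀ i j, ∑ k, A x i k * (A x).adjugate k j = if i = j then (A x).det else 0 := by
    intro i j
    have := congrFun (congrFun (Matrix.mul_adjugate (A x)) i) j
    simpa [Matrix.mul_apply, Matrix.one_apply] using this
  have hadj' : ∀ i j, ∑ k, (A x).adjugate i k * A x k j = if i = j then (A x).det else 0 := by
    intro i j
    have := congrFun (congrFun (Matrix.adjugate_mul (A x)) i) j
    simpa [Matrix.mul_apply, Matrix.one_apply] using this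
  -- Multiplying `A v = a` by the adjugate: this is the statement that the vector dual to `a` is
  -- `v`.
  have hadja : ∀ i, ∑ j, (A x).adjugate i j * a x j = (A x).det * v x i := by
    intro i
    simp_rw [← hAv, Finset.mul_sum]
    rw [Finset.sum_comm]
    have : ∀ k, ∑ j, (A x).adjugate i j * (v x k * A x k j)
        = v x k * if i = k then (A x).det else 0 := by
      intro k
      rw [← hadj' i k, Finset.mul_sum]
      exact Finset.sum_congr rfl fun j _ => by rw [hsA k j]; ring
    simp_rw [this]
    simp [mul_comm]
  have hadja' : ∀ i, ∑ j, (A x).adjugate j i * a x j = (A x).det * v x i := by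
    intro i
    rw [← hadja i]
    have hT : (A x).transpose = A x := by ext i j; exact hsA j i
    have : ∀ i j, (A x).adjugate j i = (A x).adjugate i j := by
      intro i j
      have := congrFun (congrFun (Matrix.adjugate_transpose (A x)) i) j
      rw [hT] at this; simpa using this
    simp_rw [this i]
  -- the derivative of `A`
  set β : Fin n → ℝ := fun i => a' i + ∑ k, J k i * a x k with hβdef
  -- `β` is the Lie derivative of the 1-form `a` along `v`; it annihilates `v` because `⟨a, v⟩` is
  -- constant.
  have hβv : ∑ i, β i * v x i = 0 := by
    rw [← hβ]
    simp only [hβdef, add_mul, Finset.sum_add_distrib, Finset.sum_mul]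
    congr 1
    rw [Finset.sum_comm]
    exact Finset.sum_congr rfl fun i _ => Finset.sum_congr rfl fun j _ => by ring
  -- In invariant terms: the Lie derivative of `A` along `v` is `a ⊗ β + β ⊗ a`, the one of `h`
  -- being zero.
  have hder : ∀ i j, fderiv ℝ (fun y => h y i j) x (v x) + (a x i * a' j + a x j * a' i)
      = a x i * β j + a x j * β i - (∑ k, J k i * A x k j + ∑ k, J k j * A x i k) := by
    intro i j
    have := hLie i j
    simp only [hAdef, hβdef, Matrix.add_apply, Matrix.vecMulVec_apply, mul_add,
      Finset.sum_add_distrib]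
    have e1 : ∑ k, J k i * (a x k * a x j) = a x j * ∑ k, J k i * a x k := by
      rw [Finset.mul_sum]; exact Finset.sum_congr rfl fun k _ => by ring
    have e2 : ∑ k, J k j * (a x i * a x k) = a x i * ∑ k, J k j * a x k := by
      rw [Finset.mul_sum]; exact Finset.sum_congr rfl fun k _ => by ring
    rw [e1, e2]
    linarith
  -- Contracted with the adjugate, the two terms in `β` become multiples of `⟨β, v⟩ = 0`, and each
  -- Jacobian term contributes `-det A` times the trace of `J`.
  have htr : ∑ i, ∑ j, (A x).adjugate j i * (fderiv ℝ (fun y => h y i j) x (v x)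
      + (a x i * a' j + a x j * a' i)) = -2 * (A x).det * ∑ i, J i i := by
    simp_rw [hder, mul_sub, mul_add, Finset.sum_sub_distrib, Finset.sum_add_distrib]
    have t1 : ∑ i, ∑ j, (A x).adjugate j i * (a x i * β j) = 0 := by
      rw [Finset.sum_comm]
      have : ∀ j, ∑ i, (A x).adjugate j i * (a x i * β j) = (A x).det * (β j * v x j) := by
        intro j
        rw [← mul_left_comm, ← hadja j, Finset.mul_sum]
        exact Finset.sum_congr rfl fun i _ => by ring
      simp_rw [this, ← Finset.mul_sum, hβv, mul_zero]
    have t2 : ∑ i, ∑ j, (A x).adjugate j i * (a x j * β i) = 0 := by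
      have : ∀ j, ∑ i, (A x).adjugate i j * (a x i * β j) = (A x).det * (β j * v x j) := by
        intro j
        rw [← mul_left_comm, ← hadja' j, Finset.mul_sum]
        exact Finset.sum_congr rfl fun i _ => by ring
      simp_rw [this, ← Finset.mul_sum, hβv, mul_zero]
    have t3 : ∑ i, ∑ j, (A x).adjugate j i * ∑ k, J k i * A x k j
        = (A x).det * ∑ i, J i i := by
      rw [Finset.mul_sum]
      refine Finset.sum_congr rfl fun i _ => ?_
      simp_rw [Finset.mul_sum]
      rw [Finset.sum_comm]
      have : ∀ k, ∑ j, (A x).adjugate j i * (J k i * A x k j)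
          = J k i * if k = i then (A x).det else 0 := by
        intro k
        rw [← hadj k i, Finset.mul_sum]
        exact Finset.sum_congr rfl fun j _ => by ring
      simp_rw [this]
      simp [mul_comm]
    have t4 : ∑ i, ∑ j, (A x).adjugate j i * ∑ k, J k j * A x i k
        = (A x).det * ∑ i, J i i := by
      rw [Finset.sum_comm, Finset.mul_sum]
      refine Finset.sum_congr rfl fun i _ => ?_
      simp_rw [Finset.mul_sum]
      rw [Finset.sum_comm]
      have : ∀ k, ∑ j, (A x).adjugate i j * (J k i * A x j k)
          = J k i * if i = k then (A x).det else 0 := by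
        intro k
        rw [← hadj' i k, Finset.mul_sum]
        exact Finset.sum_congr rfl fun j _ => by ring
      simp_rw [this]
      simp [mul_comm]
    rw [t1, t2, t3, t4]; ring
  have hsum : (∑ i, ∑ j, (A x).adjugate j i • (fderiv ℝ (fun y => h y i j) x
      + (a x i • fderiv ℝ (fun y => a y j) x + a x j • fderiv ℝ (fun y => a y i) x))) (v x)
      = -2 * (A x).det * ∑ i, J i i := by
    rw [← htr]
    simp only [sum_apply, ha', smul_apply, add_apply, smul_eq_mul]
  have hpos : 0 < √(A x).det := Real.sqrt_pos.2 hdet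
  have hsq : √(A x).det * √(A x).det = (A x).det := Real.mul_self_sqrt hdet.le
  rw [smul_apply, hsum, smul_eq_mul]
  change 1 / (2 * √(A x).det) * (-2 * (A x).det * ∑ i, J i i) + √(A x).det * ∑ i, J i i = 0
  have h2 : 1 / (2 * √(A x).det) * (-2 * (A x).det) = -√(A x).det := by
    nth_rewrite 2 [← hsq]
    field_simp
  rw [← mul_assoc, h2]
  ring

/-- A compactly supported function integrates to zero along a vector field which is divergence free
with respect to `ρ dx`. -/
theorem integral_fderiv_mul_eq_zero {n : ℕ} {Ω : Set (EuclideanSpace ℝ (Fin n))} (hΩ : IsOpen Ω)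
    {ρ u : EuclideanSpace ℝ (Fin n) → ℝ} {v : EuclideanSpace ℝ (Fin n) → EuclideanSpace ℝ (Fin n)}
    (hρ : ContDiffOn ℝ 1 ρ Ω) (hv : ContDiffOn ℝ 1 v Ω) (hu : ContDiffOn ℝ 1 u Ω)
    (hcs : HasCompactSupport u) (hsub : tsupport u ⊆ Ω)
    (hdiv : ∀ x ∈ Ω, fderiv ℝ ρ x (v x)
      + ρ x * ∑ i, fderiv ℝ v x (EuclideanSpace.single i 1) i = 0) :
    ∫ x in Ω, ρ x * fderiv ℝ u x (v x) = 0 := by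
  -- The components of the flux `u ρ v`. Although `ρ` and `v` are controlled only on `Ω`, the flux
  -- is `C^1` on the whole space, as it vanishes off the support of `u`.
  set q : Fin n → EuclideanSpace ℝ (Fin n) → ℝ := fun i x => u x * (ρ x * v x i) with hq
  have hvi : ∀ i, ContDiffOn ℝ 1 (fun x => v x i) Ω := fun i =>
    (EuclideanSpace.proj (𝕜 := ℝ) i).contDiff.comp_contDiffOn hv
  have hsupp : ∀ i, tsupport (q i) ⊆ tsupport u := fun i => tsupport_mul_subset_left
  have hqc : ∀ i, ContDiff ℝ 1 (q i) := by
    intro i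
    rw [contDiff_iff_contDiffAt]
    intro x
    by_cases hx : x ∈ tsupport u
    · have hxΩ := hΩ.mem_nhds (hsub hx)
      exact ((hu.mul (hρ.mul (hvi i))).contDiffAt hxΩ)
    · have : q i =ᶠ[𝓝 x] fun _ => 0 := by
        have h1 := notMem_tsupport_iff_eventuallyEq.1 hx
        filter_upwards [h1] with y hy
        simp [hq, hy]
      exact contDiffAt_const.congr_of_eventuallyEq this
  have hqs : ∀ i, HasCompactSupport (q i) := fun i =>
    hcs.mono' ((subset_tsupport _).trans (hsupp i))
  have hint : ∀ i, Integrable (fun x => fderiv ℝ (q i) x (EuclideanSpace.single i 1)) := by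
    intro i
    refine Continuous.integrable_of_hasCompactSupport ?_ ?_
    · exact ((hqc i).continuous_fderiv (by norm_num)).clm_apply continuous_const
    · exact (hqs i).fderiv_apply (𝕜 := ℝ) _
  have hzero : ∀ i, ∫ x, fderiv ℝ (q i) x (EuclideanSpace.single i 1) = 0 := by
    intro i
    -- Integration by parts against the constant function 1.
    have := integral_mul_fderiv_eq_neg_fderiv_mul_of_integrable (μ := volume)
      (f := fun _ : EuclideanSpace ℝ (Fin n) => (1 : ℝ)) (g := q i)
      (v := EuclideanSpace.single i 1) (by simp) (by simpa using hint i)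
      (by simpa using (hqc i).continuous.integrable_of_hasCompactSupport (hqs i))
      (fun x _ => differentiableAt_const _) (fun x _ => (hqc i).differentiable (by norm_num) x)
    simpa using this
  -- The divergence of `u ρ v` is `ρ du(v) + u div(ρ v)`, and the last term vanishes.
  have hpt : ∀ x ∈ Ω, ρ x * fderiv ℝ u x (v x)
      = ∑ i, fderiv ℝ (q i) x (EuclideanSpace.single i 1) := by
    intro x hx
    have hxΩ := hΩ.mem_nhds hx
    have du := ((hu.contDiffAt hxΩ).differentiableAt (by norm_num)).hasFDerivAt
    have dρ := ((hρ.contDiffAt hxΩ).differentiableAt (by norm_num)).hasFDerivAt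
    have dv := ((hv.contDiffAt hxΩ).differentiableAt (by norm_num)).hasFDerivAt
    have dvi : ∀ i, HasFDerivAt (fun y => v y i)
        ((EuclideanSpace.proj i).comp (fderiv ℝ v x)) x :=
      fun i => ((EuclideanSpace.proj (𝕜 := ℝ) i).hasFDerivAt).comp x dv
    have hvx : v x = ∑ i, v x i • EuclideanSpace.single i (1 : ℝ) := by
      ext j; simp [Pi.single_apply]
    have e1 : ∀ L : EuclideanSpace ℝ (Fin n) →L[ℝ] ℝ,
        L (v x) = ∑ i, v x i * L (EuclideanSpace.single i 1) := by
      intro L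
      conv_lhs => rw [hvx]
      simp
    have e2 : ∀ i, fderiv ℝ (q i) x (EuclideanSpace.single i 1)
        = ρ x * (v x i * fderiv ℝ u x (EuclideanSpace.single i 1))
          + u x * (v x i * fderiv ℝ ρ x (EuclideanSpace.single i 1)
            + ρ x * fderiv ℝ v x (EuclideanSpace.single i 1) i) := by
      intro i
      have hqi : HasFDerivAt (q i) _ x := du.mul (dρ.mul (dvi i))
      rw [hqi.fderiv]
      simp
      ring
    have := hdiv x hx
    rw [e1] at this
    simp_rw [e2, Finset.sum_add_distrib, ← Finset.mul_sum, Finset.sum_add_distrib, ← Finset.mul_sum,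
      this, mul_zero, add_zero, ← e1]
  rw [setIntegral_congr_fun hΩ.measurableSet hpt, setIntegral_eq_integral_of_forall_compl_eq_zero,
    integral_finsetSum _ fun i _ => hint i]
  · simp [hzero]
  · intro x hx
    refine Finset.sum_eq_zero fun i _ => ?_
    have hx' : x ∉ tsupport (q i) := fun h => hx (hsub (hsupp i h))
    rw [fderiv_of_notMem_tsupport ℝ hx']
    simp

/-! ### Coordinate expressions of tangent vectors -/

section Charts

variable {m : ℕ} {M : Type*} [TopologicalSpace M] [ChartedSpace (EuclideanSpace ℝ (Fin m)) M]

/-- The linear map `v ↦ coordVec c y v`. -/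
def coordMap (c y : M) : TangentSpace (𝓡 m) y →L[ℝ] EuclideanSpace ℝ (Fin m) :=
  mfderiv (𝓡 m) 𝓘(ℝ, EuclideanSpace ℝ (Fin m)) (extChartAt (𝓡 m) c) y

/-- The linear map `v ↦ ofCoordVec c x v`. -/
def ofCoordMap (c : M) (x : EuclideanSpace ℝ (Fin m)) :
    EuclideanSpace ℝ (Fin m) →L[ℝ] TangentSpace (𝓡 m) ((extChartAt (𝓡 m) c).symm x) :=
  mfderiv 𝓘(ℝ, EuclideanSpace ℝ (Fin m)) (𝓡 m) (extChartAt (𝓡 m) c).symm x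

theorem coordVec_eq_coordMap (c y : M) (v : TangentSpace (𝓡 m) y) :
    coordVec c y v = coordMap c y v := rfl

theorem coordVec_smul (c y : M) (r : ℝ) (v : TangentSpace (𝓡 m) y) :
    coordVec c y (r • v) = r • coordVec c y v :=
  map_smul (coordMap c y) r v

theorem ofCoordVec_eq_ofCoordMap (c : M) (x v : EuclideanSpace ℝ (Fin m)) :
    ofCoordVec c x v = ofCoordMap c x v := rfl

theorem eq_sum_stdVec (v : EuclideanSpace ℝ (Fin m)) : v = ∑ i, v i • stdVec i := by
  ext j; simp [stdVec, Pi.single_apply]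

theorem ofCoordVec_eq_sum (c : M) (x v : EuclideanSpace ℝ (Fin m)) :
    ofCoordVec c x v = ∑ i, v i • ofCoordVec c x (stdVec i) := by
  simp only [ofCoordVec_eq_ofCoordMap]
  conv_lhs => rw [eq_sum_stdVec v]
  simp only [map_sum, map_smul]

variable [IsManifold (𝓡 m) 3 M]

theorem coordVec_ofCoordVec {c : M} {x : EuclideanSpace ℝ (Fin m)}
    (hx : x ∈ (extChartAt (𝓡 m) c).target) (w : EuclideanSpace ℝ (Fin m)) :
    coordVec c ((extChartAt (𝓡 m) c).symm x) (ofCoordVec c x w) = w := by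
  have h := mfderiv_extChartAt_comp_mfderivWithin_extChartAt_symm (I := 𝓡 m) (x := c) hx
  rw [show range (𝓡 m) = univ from ModelWithCorners.range_eq_univ _, mfderivWithin_univ] at h
  exact congrArg (fun L => L w) h

/-- The two sides are tangent vectors at points that are equal only propositionally, whence the
comparison in the model space. -/
theorem ofCoordVec_coordVec {c q : M} (hq : q ∈ (extChartAt (𝓡 m) c).source)
    (v : TangentSpace (𝓡 m) q) :
    (ofCoordVec c (extChartAt (𝓡 m) c q) (coordVec c q v) : EuclideanSpace ℝ (Fin m)) = v := by
  have h := mfderivWithin_extChartAt_symm_comp_mfderiv_extChartAt' (I := 𝓡 m) (x := c) hq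
  rw [show range (𝓡 m) = univ from ModelWithCorners.range_eq_univ _, mfderivWithin_univ] at h
  exact congrArg (fun L => L v) h

theorem coordVec_injective {c q : M} (hq : q ∈ (extChartAt (𝓡 m) c).source) :
    Function.Injective (coordVec (m := m) c q) := by
  intro v w h
  have h1 := ofCoordVec_coordVec hq v
  rw [h, ofCoordVec_coordVec hq w] at h1
  exact h1.symm

theorem ofCoordVec_coordVec_symm {c : M} {x : EuclideanSpace ℝ (Fin m)}
    (hx : x ∈ (extChartAt (𝓡 m) c).target)
    (v : TangentSpace (𝓡 m) ((extChartAt (𝓡 m) c).symm x)) :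
    ofCoordVec c x (coordVec c ((extChartAt (𝓡 m) c).symm x) v) = v :=
  coordVec_injective ((extChartAt (𝓡 m) c).map_target hx) (coordVec_ofCoordVec hx _)

/-- This is a constant field transported by the tangent map of the inverse chart; that map costs one
derivative, so the `C^3` structure yields `C^2`. -/
theorem contMDiffOn_ofCoordVec (c : M) (w : EuclideanSpace ℝ (Fin m)) :
    ContMDiffOn 𝓘(ℝ, EuclideanSpace ℝ (Fin m)) (𝓡 m).tangent 2
      (fun x => (⟨(extChartAt (𝓡 m) c).symm x, ofCoordVec c x w⟩ : TangentBundle (𝓡 m) M))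
      (extChartAt (𝓡 m) c).target := by
  have hopen := isOpen_extChartAt_target (I := 𝓡 m) c
  have h := (contMDiffOn_extChartAt_symm (I := 𝓡 m) (n := 3) c).contMDiffOn_tangentMapWithin
    (m := 2) (by norm_num) hopen.uniqueMDiffOn
  have hc : ContMDiff 𝓘(ℝ, EuclideanSpace ℝ (Fin m)) 𝓘(ℝ, EuclideanSpace ℝ (Fin m)).tangent 2
      (fun x => (⟨x, w⟩ : TangentBundle 𝓘(ℝ, EuclideanSpace ℝ (Fin m))
        (EuclideanSpace ℝ (Fin m)))) :=
    contMDiff_vectorSpace_iff_contDiff.2 contDiff_const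
  have h2 := h.comp hc.contMDiffOn (s := (extChartAt (𝓡 m) c).target) (fun x hx => hx)
  refine h2.congr fun x hx => ?_
  simp only [Function.comp_apply, tangentMapWithin, ofCoordVec]
  rw [mfderivWithin_of_isOpen hopen hx]

theorem contMDiffAt_coordVec {E' H' N : Type*} [NormedAddCommGroup E'] [NormedSpace ℝ E']
    [TopologicalSpace H'] {I' : ModelWithCorners ℝ E' H'} [TopologicalSpace N] [ChartedSpace H' N]
    {f : N → TangentBundle (𝓡 m) M} {x : N} {c : M} {k : WithTop ℕ∞} (hk : k ≤ 2)
    (hf : ContMDiffAt I' (𝓡 m).tangent k f x) (hx : (f x).1 ∈ (extChartAt (𝓡 m) c).source) :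
    ContMDiffAt I' 𝓘(ℝ, EuclideanSpace ℝ (Fin m)) k (fun y => coordVec c (f y).1 (f y).2) x := by
  have hopen := isOpen_extChartAt_source (I := 𝓡 m) c
  have h := (contMDiffOn_extChartAt (I := 𝓡 m) (n := 3) (x := c))
  rw [← extChartAt_source (𝓡 m)] at h
  have h1 := (h.contMDiffOn_tangentMapWithin (m := 2) (by norm_num) hopen.uniqueMDiffOn).of_le hk
  have hnhds : (TotalSpace.proj ⁻¹' (extChartAt (𝓡 m) c).source :
      Set (TangentBundle (𝓡 m) M)) ∈ 𝓝 (f x) :=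
    (hopen.preimage (FiberBundle.continuous_proj _ _)).mem_nhds hx
  have h2 := (h1.contMDiffAt hnhds).comp x hf
  have h3 := ((contMDiff_snd_tangentBundle_modelSpace (EuclideanSpace ℝ (Fin m))
    𝓘(ℝ, EuclideanSpace ℝ (Fin m)) (n := k)).contMDiffAt).comp x h2
  refine h3.congr_of_eventuallyEq ?_
  filter_upwards [hf.continuousAt.preimage_mem_nhds hnhds] with y hy
  have : mfderivWithin (𝓡 m) 𝓘(ℝ, EuclideanSpace ℝ (Fin m)) (extChartAt (𝓡 m) c)
      (extChartAt (𝓡 m) c).source (f y).1 = coordMap c (f y).1 := mfderivWithin_of_isOpen hopen hy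
  exact (congrArg (fun L => L (f y).2) this).symm

end Charts

/-! ### Fields of bilinear forms in coordinates -/

section BilinearForms

variable {m : ℕ} {M : Type*} [TopologicalSpace M] [ChartedSpace (EuclideanSpace ℝ (Fin m)) M]

/-- The bilinear form on `ℝ^m` with matrix `coeffMatrix h c x`. -/
def coeffForm (h : ∀ x : M, TangentSpace (𝓡 m) x →L[ℝ] TangentSpace (𝓡 m) x →L[ℝ] ℝ)
    (c : M) (x : EuclideanSpace ℝ (Fin m)) :
    EuclideanSpace ℝ (Fin m) →L[ℝ] EuclideanSpace ℝ (Fin m) →L[ℝ] ℝ :=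
  ∑ i, ∑ j, coeffMatrix h c x i j •
    (EuclideanSpace.proj (𝕜 := ℝ) i).smulRight (EuclideanSpace.proj (𝕜 := ℝ) j)

variable (h : ∀ x : M, TangentSpace (𝓡 m) x →L[ℝ] TangentSpace (𝓡 m) x →L[ℝ] ℝ)

theorem coeffForm_apply (c : M) (x a b : EuclideanSpace ℝ (Fin m)) :
    coeffForm h c x a b = ∑ i, ∑ j, coeffMatrix h c x i j * (a i * b j) := by
  simp [coeffForm, sum_apply]

theorem coeffForm_eq (c : M) (x a b : EuclideanSpace ℝ (Fin m)) :
    coeffForm h c x a b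
      = h ((extChartAt (𝓡 m) c).symm x) (ofCoordVec c x a) (ofCoordVec c x b) := by
  rw [coeffForm_apply, ofCoordVec_eq_sum c x a, ofCoordVec_eq_sum c x b]
  simp only [map_sum, map_smul, sum_apply, smul_apply, smul_eq_mul, Finset.mul_sum]
  rw [Finset.sum_comm]
  refine Finset.sum_congr rfl fun i _ => Finset.sum_congr rfl fun j _ => ?_
  simp only [coeffMatrix, Matrix.of_apply]
  ring

theorem apply_eq_coeffForm [IsManifold (𝓡 m) 3 M] {c q : M} (hq : q ∈ (extChartAt (𝓡 m) c).source)
    (v w : TangentSpace (𝓡 m) q) :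
    h q v w = coeffForm h c (extChartAt (𝓡 m) c q) (coordVec c q v) (coordVec c q w) := by
  -- Transport of the vectors along an equality of base points.
  have key : ∀ (q' : M) (_ : q' = q) (v' w' : TangentSpace (𝓡 m) q')
      (_ : (v' : EuclideanSpace ℝ (Fin m)) = v) (_ : (w' : EuclideanSpace ℝ (Fin m)) = w),
      h q v w = h q' v' w' := by
    rintro q' rfl v' w' rfl rfl
    rfl
  rw [coeffForm_eq]
  exact key _ ((extChartAt (𝓡 m) c).left_inv hq) _ _ (ofCoordVec_coordVec hq v)
    (ofCoordVec_coordVec hq w)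

variable {E' H' N : Type*} [NormedAddCommGroup E'] [NormedSpace ℝ E']
    [TopologicalSpace H'] {I' : ModelWithCorners ℝ E' H'} [TopologicalSpace N] [ChartedSpace H' N]

theorem contMDiffAt_bilinear_apply [IsManifold (𝓡 m) 1 M] {k : WithTop ℕ∞}
    {h : ∀ x : M, TangentSpace (𝓡 m) x →L[ℝ] TangentSpace (𝓡 m) x →L[ℝ] ℝ}
    (hh : ContMDiff (𝓡 m)
      ((𝓡 m).prod 𝓘(ℝ, EuclideanSpace ℝ (Fin m) →L[ℝ] EuclideanSpace ℝ (Fin m) →L[ℝ] ℝ)) k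
      (fun x => TotalSpace.mk' (EuclideanSpace ℝ (Fin m) →L[ℝ] EuclideanSpace ℝ (Fin m) →L[ℝ] ℝ)
        (E := fun x : M => TangentSpace (𝓡 m) x →L[ℝ] TangentSpace (𝓡 m) x →L[ℝ] ℝ) x (h x)))
    {b : N → M} {v w : ∀ y, TangentSpace (𝓡 m) (b y)} {y : N}
    (hv : ContMDiffAt I' (𝓡 m).tangent k (fun y => (⟨b y, v y⟩ : TangentBundle (𝓡 m) M)) y)
    (hw : ContMDiffAt I' (𝓡 m).tangent k (fun y => (⟨b y, w y⟩ : TangentBundle (𝓡 m) M)) y) :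
    ContMDiffAt I' 𝓘(ℝ) k (fun y => h (b y) (v y) (w y)) y := by
  have hb : ContMDiffAt I' (𝓡 m) k b y := (contMDiffAt_totalSpace.1 hv).1
  have : ContMDiffAt I' ((𝓡 m).prod 𝓘(ℝ)) k
      (fun y ↦ TotalSpace.mk' ℝ (E := Bundle.Trivial M ℝ) (b y) (h (b y) (v y) (w y))) y := by
    apply ContMDiffAt.clm_bundle_apply₂ (F₁ := EuclideanSpace ℝ (Fin m))
      (F₂ := EuclideanSpace ℝ (Fin m))
    · exact ContMDiffAt.comp y hh.contMDiffAt hb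
    · exact hv
    · exact hw
  exact (contMDiffAt_totalSpace.1 this).2

theorem contMDiffAt_linear_apply [IsManifold (𝓡 m) 1 M] {k : WithTop ℕ∞}
    {α : ∀ x : M, TangentSpace (𝓡 m) x →L[ℝ] ℝ}
    (hα : ContMDiff (𝓡 m) ((𝓡 m).prod 𝓘(ℝ, EuclideanSpace ℝ (Fin m) →L[ℝ] ℝ)) k
      (fun x => TotalSpace.mk' (EuclideanSpace ℝ (Fin m) →L[ℝ] ℝ)
        (E := fun x : M => TangentSpace (𝓡 m) x →L[ℝ] ℝ) x (α x)))
    {b : N → M} {v : ∀ y, TangentSpace (𝓡 m) (b y)} {y : N}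
    (hv : ContMDiffAt I' (𝓡 m).tangent k (fun y => (⟨b y, v y⟩ : TangentBundle (𝓡 m) M)) y) :
    ContMDiffAt I' 𝓘(ℝ) k (fun y => α (b y) (v y)) y := by
  have hb : ContMDiffAt I' (𝓡 m) k b y := (contMDiffAt_totalSpace.1 hv).1
  have : ContMDiffAt I' ((𝓡 m).prod 𝓘(ℝ)) k
      (fun y ↦ TotalSpace.mk' ℝ (E := Bundle.Trivial M ℝ) (b y) (α (b y) (v y))) y := by
    apply ContMDiffAt.clm_bundle_apply (F₁ := EuclideanSpace ℝ (Fin m))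
    · exact ContMDiffAt.comp y hα.contMDiffAt hb
    · exact hv
  exact (contMDiffAt_totalSpace.1 this).2

end BilinearForms

/-! ### Lorentzian linear algebra and the Christoffel symbols in a chart. -/

section Metric

variable {m : ℕ} {M : Type*} [TopologicalSpace M]
    [ChartedSpace (EuclideanSpace ℝ (Fin m)) M] [IsManifold (𝓡 m) 4 M] (g : Spacetime m M)

namespace Spacetime

theorem contDiffAt_coeffMatrix {c : M} {x : EuclideanSpace ℝ (Fin m)}
    (hx : x ∈ (extChartAt (𝓡 m) c).target) (i j : Fin m) :
    ContDiffAt ℝ 1 (fun y => coeffMatrix g.metric c y i j) x := by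
  have hn := (isOpen_extChartAt_target (I := 𝓡 m) c).mem_nhds hx
  have h1 := fun w => ((contMDiffOn_ofCoordVec c w).contMDiffAt hn).of_le
    (show (1 : WithTop ℕ∞) ≤ 2 by norm_num)
  exact (contMDiffAt_bilinear_apply (g.contMDiff.of_le (by norm_num)) (h1 (stdVec i))
    (h1 (stdVec j))).contDiffAt

theorem hasFDerivAt_sum_coeffMatrix_smul {c : M} {x : EuclideanSpace ℝ (Fin m)}
    (hx : x ∈ (extChartAt (𝓡 m) c).target) {W : Type*} [NormedAddCommGroup W] [NormedSpace ℝ W]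
    (T : Fin m → Fin m → W) :
    HasFDerivAt (fun y => ∑ i, ∑ j, coeffMatrix g.metric c y i j • T i j) (∑ i, ∑ j,
      (fderiv ℝ (fun y => coeffMatrix g.metric c y i j) x).smulRight (T i j)) x :=
  HasFDerivAt.fun_sum fun i _ => HasFDerivAt.fun_sum fun j _ =>
    ((g.contDiffAt_coeffMatrix hx i j).differentiableAt (by norm_num)).hasFDerivAt.smul_const _

theorem differentiableAt_coeffForm {c : M} {x : EuclideanSpace ℝ (Fin m)}
    (hx : x ∈ (extChartAt (𝓡 m) c).target) :
    DifferentiableAt ℝ (coeffForm g.metric c) x :=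
  (g.hasFDerivAt_sum_coeffMatrix_smul hx fun i j =>
    (EuclideanSpace.proj (𝕜 := ℝ) i).smulRight (EuclideanSpace.proj (𝕜 := ℝ) j)).differentiableAt

theorem fderiv_coeffForm_apply {c : M} {x : EuclideanSpace ℝ (Fin m)}
    (hx : x ∈ (extChartAt (𝓡 m) c).target) (a b d : EuclideanSpace ℝ (Fin m)) :
    fderiv ℝ (coeffForm g.metric c) x a b d = ∑ i, ∑ j,
      fderiv ℝ (fun y => coeffMatrix g.metric c y i j) x a * (b i * d j) := by
  have h := (g.hasFDerivAt_sum_coeffMatrix_smul hx fun i j =>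
    (EuclideanSpace.proj (𝕜 := ℝ) i).smulRight (EuclideanSpace.proj (𝕜 := ℝ) j)).fderiv
  have h' : fderiv ℝ (coeffForm g.metric c) x = _ := h
  rw [h']
  simp [sum_apply]

theorem coeffMatrix_symm (c : M) (x : EuclideanSpace ℝ (Fin m)) (i j : Fin m) :
    coeffMatrix g.metric c x i j = coeffMatrix g.metric c x j i :=
  g.symm _ _ _

theorem coeffForm_symm (c : M) (x a b : EuclideanSpace ℝ (Fin m)) :
    coeffForm g.metric c x a b = coeffForm g.metric c x b a := by
  rw [coeffForm_eq, coeffForm_eq, g.symm]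

variable {g} in
/-- A vector orthogonal to a lightlike vector `k` is spacelike or proportional to `k`. -/
theorem nonneg_of_orthogonal {x : M} {k v : TangentSpace (𝓡 m) x} (hk : k ≠ 0)
    (hkk : g.metric x k k = 0) (hkv : g.metric x k v = 0) :
    0 ≤ g.metric x v v ∧ (g.metric x v v = 0 → ∃ r : ℝ, v = r • k) := by
  obtain ⟨t, ht, hpos⟩ := g.signature x
  -- The metric is positive definite on the complement of the timelike vector `t`, so the null
  -- vector `k` cannot lie there. Hence `r` below can be chosen with `v - r k` orthogonal to `t`;
  -- this shift does not change the norm, as `k` is null and orthogonal to `v`.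
  have hkt : g.metric x t k ≠ 0 := fun h => (hpos k h hk).ne' hkk
  set r : ℝ := g.metric x t v / g.metric x t k with hr
  have hw0 : g.metric x t (v - r • k) = 0 := by
    simp only [map_sub, map_smul, smul_eq_mul, hr]
    field_simp
    ring
  have hww : g.metric x (v - r • k) (v - r • k) = g.metric x v v := by
    have hvk : g.metric x v k = 0 := by rw [g.symm]; exact hkv
    simp only [map_sub, map_smul, smul_eq_mul, sub_apply, smul_apply,
      hkk, hkv, hvk]
    ring
  by_cases hw : v - r • k = 0
  · have hv := sub_eq_zero.1 hw
    refine ⟨?_, fun _ => ⟨r, hv⟩⟩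
    rw [← hww, hw]; simp
  · have := hpos _ hw0 hw
    rw [hww] at this
    exact ⟨this.le, fun h => absurd h this.ne'⟩

theorem eq_zero_of_forall_metric_eq_zero {x : M} {v : TangentSpace (𝓡 m) x}
    (hv : ∀ w, g.metric x v w = 0) : v = 0 := by
  by_contra h
  obtain ⟨t, ht, hpos⟩ := g.signature x
  have := hpos v (by rw [g.symm]; exact hv t) h
  exact this.ne' (hv v)

/-- A kernel vector of the Gram matrix would be orthogonal to every tangent vector. This makes the
matrix inverse in `christoffel` a genuine inverse. -/
theorem det_coeffMatrix_ne_zero {c : M} {x : EuclideanSpace ℝ (Fin m)}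
    (hx : x ∈ (extChartAt (𝓡 m) c).target) : (coeffMatrix g.metric c x).det ≠ 0 := by
  intro h0
  obtain ⟨v, hv, hv0⟩ := Matrix.exists_vecMul_eq_zero_iff.2 h0
  set a : EuclideanSpace ℝ (Fin m) := WithLp.toLp 2 v with ha
  have h1 : ofCoordVec c x a = 0 := by
    refine g.eq_zero_of_forall_metric_eq_zero fun w => ?_
    rw [← ofCoordVec_coordVec_symm hx w, ← coeffForm_eq, coeffForm_apply, Finset.sum_comm]
    refine Finset.sum_eq_zero fun j _ => ?_
    have := congrFun hv0 j
    simp only [Matrix.vecMul, dotProduct, Pi.zero_apply] at this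
    calc _ = (∑ i, v i * coeffMatrix g.metric c x i j) *
          coordVec c ((extChartAt (𝓡 m) c).symm x) w j := by
          rw [Finset.sum_mul]
          exact Finset.sum_congr rfl fun i _ => by simp only [ha]; ring
      _ = 0 := by rw [this, zero_mul]
  have h2 := coordVec_ofCoordVec hx a
  rw [h1, coordVec_eq_coordMap, map_zero] at h2
  apply hv
  funext i
  simpa [ha] using (congrArg (fun z : EuclideanSpace ℝ (Fin m) => z i) h2).symm

/-- The bilinear map `(a, b) ↦ ∑ Γ^k_{ij} a^i b^j`. -/
def christoffelMap (c : M) (x a b : EuclideanSpace ℝ (Fin m)) : EuclideanSpace ℝ (Fin m) :=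
  WithLp.toLp 2 fun k => ∑ i, ∑ j, christoffel g.metric c x k i j * a i * b j

/-- Lowering the upper index of the Christoffel symbols cancels the inverse matrix. The result is
the Koszul formula in the form required by `lieDerivative_pullback_eq_zero`. -/
theorem coeffForm_christoffelMap {c : M} {x : EuclideanSpace ℝ (Fin m)}
    (hx : x ∈ (extChartAt (𝓡 m) c).target) (a b d : EuclideanSpace ℝ (Fin m)) :
    coeffForm g.metric c x (g.christoffelMap c x a b) d = (1 / 2 : ℝ) *
      (fderiv ℝ (coeffForm g.metric c) x a b d + fderiv ℝ (coeffForm g.metric c) x b a d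
        - fderiv ℝ (coeffForm g.metric c) x d a b) := by
  set G := coeffMatrix g.metric c x with hG
  set D : Fin m → Fin m → Fin m → ℝ :=
    fun k i j => fderiv ℝ (fun y => coeffMatrix g.metric c y i j) x (stdVec k) with hD
  have hDs : ∀ k i j, D k i j = D k j i := by
    intro k i j
    simp only [hD]
    congr 2
    funext y
    exact g.coeffMatrix_symm c y i j
  have hinv : ∀ l s, ∑ k, G k s * G⁻¹ k l = if l = s then 1 else 0 := by
    intro l s
    have h1 := Matrix.mul_nonsing_inv G (isUnit_iff_ne_zero.2 (g.det_coeffMatrix_ne_zero hx))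
    have h2 := congrFun (congrFun h1 s) l
    rw [Matrix.mul_apply, Matrix.one_apply] at h2
    simp only [eq_comm (a := l)]
    rw [← h2]
    exact Finset.sum_congr rfl fun k _ => by rw [hG, g.coeffMatrix_symm c x k s]
  have hlow : ∀ i j s, ∑ k, G k s * christoffel g.metric c x k i j
      = (1 / 2 : ℝ) * (D i j s + D j i s - D s i j) := by
    intro i j s
    simp only [christoffel, ← hG]
    calc ∑ k, G k s * (1 / 2 * ∑ l, G⁻¹ k l * (D i j l + D j i l - D l i j))
        = 1 / 2 * ∑ l, (∑ k, G k s * G⁻¹ k l) * (D i j l + D j i l - D l i j) := by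
          simp only [Finset.mul_sum, Finset.sum_mul]
          rw [Finset.sum_comm]
          exact Finset.sum_congr rfl fun l _ => Finset.sum_congr rfl fun k _ => by ring
      _ = _ := by simp [hinv]
  have hder : ∀ u v w, fderiv ℝ (coeffForm g.metric c) x u v w
      = ∑ i, ∑ j, ∑ k, D k i j * u k * v i * w j := by
    intro u v w
    rw [g.fderiv_coeffForm_apply hx]
    refine Finset.sum_congr rfl fun i _ => Finset.sum_congr rfl fun j _ => ?_
    conv_lhs => rw [eq_sum_stdVec u]
    simp only [map_sum, map_smul, smul_eq_mul, Finset.sum_mul, hD]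
    exact Finset.sum_congr rfl fun k _ => by ring
  have e1 : fderiv ℝ (coeffForm g.metric c) x a b d
      = ∑ s, ∑ i, ∑ j, D i j s * a i * b j * d s := by
    rw [hder, Finset.sum_comm]
    exact Finset.sum_congr rfl fun s _ => Finset.sum_comm
  have e2 : fderiv ℝ (coeffForm g.metric c) x b a d
      = ∑ s, ∑ i, ∑ j, D j i s * a i * b j * d s := by
    rw [hder, Finset.sum_comm]
    exact Finset.sum_congr rfl fun s _ => Finset.sum_congr rfl fun i _ =>
      Finset.sum_congr rfl fun j _ => by ring
  have e3 : fderiv ℝ (coeffForm g.metric c) x d a b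
      = ∑ s, ∑ i, ∑ j, D s i j * a i * b j * d s := by
    rw [hder]
    have : ∀ i, ∑ j, ∑ k, D k i j * d k * a i * b j = ∑ k, ∑ j, D k i j * a i * b j * d k := by
      intro i
      rw [Finset.sum_comm]
      exact Finset.sum_congr rfl fun i _ => Finset.sum_congr rfl fun j _ => by ring
    simp_rw [this]
    exact Finset.sum_comm
  rw [e1, e2, e3, ← Finset.sum_add_distrib, ← Finset.sum_sub_distrib, Finset.mul_sum,
    coeffForm_apply, Finset.sum_comm]
  refine Finset.sum_congr rfl fun s _ => ?_
  simp_rw [← Finset.sum_add_distrib, ← Finset.sum_sub_distrib, Finset.mul_sum]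
  have : ∀ i j, (1 / 2 : ℝ) * (D i j s * a i * b j * d s + D j i s * a i * b j * d s
      - D s i j * a i * b j * d s)
      = ∑ k, G k s * (christoffel g.metric c x k i j * a i * b j * d s) := by
    intro i j
    calc _ = (1 / 2 : ℝ) * (D i j s + D j i s - D s i j) * (a i * b j * d s) := by ring
      _ = _ := by
        rw [← hlow, Finset.sum_mul]
        exact Finset.sum_congr rfl fun k _ => by ring
  simp_rw [this]
  rw [Finset.sum_comm_cycle]
  refine Finset.sum_congr rfl fun k _ => ?_
  simp only [christoffelMap, Finset.sum_mul, Finset.mul_sum, hG]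

end Spacetime

end Metric

/-! ### Hypersurfaces in coordinates -/

section Field

variable {n : ℕ} {H : Type*} [TopologicalSpace H] [ChartedSpace (EuclideanSpace ℝ (Fin n)) H]

/-- The coordinate expression of a vector field. -/
def fieldCoord (c : H) (l : ∀ p : H, TangentSpace (𝓡 n) p) (x : EuclideanSpace ℝ (Fin n)) :
    EuclideanSpace ℝ (Fin n) :=
  coordVec c ((extChartAt (𝓡 n) c).symm x) (l ((extChartAt (𝓡 n) c).symm x))

variable [IsManifold (𝓡 n) 3 H]

theorem ofCoordVec_fieldCoord {c : H} (l : ∀ p : H, TangentSpace (𝓡 n) p)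
    {x : EuclideanSpace ℝ (Fin n)} (hx : x ∈ (extChartAt (𝓡 n) c).target) :
    ofCoordVec c x (fieldCoord c l x) = l ((extChartAt (𝓡 n) c).symm x) :=
  ofCoordVec_coordVec_symm hx _

theorem contMDiffAt_extChartAt_symm {c : H} {x : EuclideanSpace ℝ (Fin n)}
    (hx : x ∈ (extChartAt (𝓡 n) c).target) :
    ContMDiffAt 𝓘(ℝ, EuclideanSpace ℝ (Fin n)) (𝓡 n) 3 (extChartAt (𝓡 n) c).symm x :=
  (contMDiffOn_extChartAt_symm c).contMDiffAt
    ((isOpen_extChartAt_target (I := 𝓡 n) c).mem_nhds hx)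

theorem contDiffOn_fieldCoord {c : H} {l : ∀ p : H, TangentSpace (𝓡 n) p}
    (hl : ContMDiff (𝓡 n) (𝓡 n).tangent 1 fun p => (⟨p, l p⟩ : TangentBundle (𝓡 n) H)) :
    ContDiffOn ℝ 1 (fieldCoord c l) (extChartAt (𝓡 n) c).target := by
  intro x hx
  have h1 := (hl.contMDiffAt (x := (extChartAt (𝓡 n) c).symm x)).comp x
    ((contMDiffAt_extChartAt_symm hx).of_le (by norm_num))
  exact (contMDiffAt_coordVec (by norm_num) h1
    ((extChartAt (𝓡 n) c).map_target hx)).contDiffAt.contDiffWithinAt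

/-- The derivative of a function on a manifold, computed in a chart. -/
theorem mfderiv_ofCoordVec {E : Type*} [NormedAddCommGroup E] [NormedSpace ℝ E] {F : H → E} {c : H}
    {x : EuclideanSpace ℝ (Fin n)} (hx : x ∈ (extChartAt (𝓡 n) c).target)
    (hF : MDifferentiableAt (𝓡 n) 𝓘(ℝ, E) F ((extChartAt (𝓡 n) c).symm x))
    (w : EuclideanSpace ℝ (Fin n)) :
    (mfderiv (𝓡 n) 𝓘(ℝ, E) F ((extChartAt (𝓡 n) c).symm x) (ofCoordVec c x w) : E)
      = fderiv ℝ (fun y => F ((extChartAt (𝓡 n) c).symm y)) x w := by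
  have h := mfderiv_comp x hF
    ((contMDiffAt_extChartAt_symm hx).mdifferentiableAt (by norm_num))
  rw [← mfderiv_eq_fderiv]
  exact (congrArg (fun L => L w) h).symm

theorem eventually_mem_chart {m : ℕ} {M : Type*} [TopologicalSpace M]
    [ChartedSpace (EuclideanSpace ℝ (Fin m)) M] {ι : H → M} (hι : Continuous ι) {c : H} {q : M}
    {x : EuclideanSpace ℝ (Fin n)} (hx : x ∈ (extChartAt (𝓡 n) c).target)
    (hq : ι ((extChartAt (𝓡 n) c).symm x) ∈ (extChartAt (𝓡 m) q).source) :
    ∀ᶠ y in 𝓝 x, y ∈ (extChartAt (𝓡 n) c).target ∧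
      ι ((extChartAt (𝓡 n) c).symm y) ∈ (extChartAt (𝓡 m) q).source := by
  have h1 : ContinuousAt (fun y => ι ((extChartAt (𝓡 n) c).symm y)) x :=
    hι.continuousAt.comp (contMDiffAt_extChartAt_symm hx).continuousAt
  filter_upwards [(isOpen_extChartAt_target (I := 𝓡 n) c).mem_nhds hx,
    h1.preimage_mem_nhds ((isOpen_extChartAt_source (I := 𝓡 m) q).mem_nhds hq)] with y h2 h3
  exact ⟨h2, h3⟩

end Field

section Hypersurface

variable {n : ℕ}
  {M : Type*} [TopologicalSpace M] [ChartedSpace (EuclideanSpace ℝ (Fin (n + 1))) M]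
  [IsManifold (𝓡 (n + 1)) 4 M]
  {H : Type*} [TopologicalSpace H] [ChartedSpace (EuclideanSpace ℝ (Fin n)) H]
  {g : Spacetime (n + 1) M} {ι : H → M}

theorem transverseMetric_apply (p : H) (v w : TangentSpace (𝓡 n) p) :
    transverseMetric g ι p v w = g.metric (ι p) (push ι p v) (push ι p w) := rfl

theorem transverseMetric_symm (p : H) (v w : TangentSpace (𝓡 n) p) :
    transverseMetric g ι p v w = transverseMetric g ι p w v := by
  rw [transverseMetric_apply, transverseMetric_apply, g.symm]

/-- `covDeriv` is built from its components by the inverse chart, and the same chart recovers them.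
The derivative enters as a variable `dN`, so that its value computed in any chart of `H` can be
substituted. -/
theorem coordVec_covDeriv_self (N : ∀ r : H, TangentSpace (𝓡 (n + 1)) (ι r)) (p : H)
    (X : TangentSpace (𝓡 n) p) (dN : EuclideanSpace ℝ (Fin (n + 1)))
    (hdN : mfderiv (𝓡 n) 𝓘(ℝ, EuclideanSpace ℝ (Fin (n + 1)))
      (fun r => coordVec (ι p) (ι r) (N r)) p X = dN) :
    coordVec (ι p) (ι p) (covDeriv g ι N p X)
      = dN + g.christoffelMap (ι p) (extChartAt (𝓡 (n + 1)) (ι p) (ι p))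
          (coordVec (ι p) (ι p) (push ι p X)) (coordVec (ι p) (ι p) (N p)) := by
  rw [← hdN]
  have hsrc : ι p ∈ (extChartAt (𝓡 (n + 1)) (ι p)).source := mem_extChartAt_source (ι p)
  have h0 := mfderiv_extChartAt_comp_mfderivWithin_extChartAt_symm' (I := 𝓡 (n + 1)) hsrc
  rw [show range (𝓡 (n + 1)) = univ from ModelWithCorners.range_eq_univ _, mfderivWithin_univ] at h0
  have h1 : ∀ u : EuclideanSpace ℝ (Fin (n + 1)), coordVec (ι p) (ι p)
      (mfderiv 𝓘(ℝ, EuclideanSpace ℝ (Fin (n + 1))) (𝓡 (n + 1)) (extChartAt (𝓡 (n + 1)) (ι p)).symm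
        (extChartAt (𝓡 (n + 1)) (ι p) (ι p)) u) = u :=
    fun u => congrArg (fun L => L u) h0
  exact h1 _

variable [IsManifold (𝓡 n) 3 H]

/-- The expression of `ι` in the chart around `c` of `H` and the chart around `q` of `M`. -/
def localMap (ι : H → M) (c : H) (q : M) (x : EuclideanSpace ℝ (Fin n)) :
    EuclideanSpace ℝ (Fin (n + 1)) :=
  extChartAt (𝓡 (n + 1)) q (ι ((extChartAt (𝓡 n) c).symm x))

theorem contDiffAt_localMap (hι : ContMDiff (𝓡 n) (𝓡 (n + 1)) 3 ι) {c : H} {q : M}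
    {x : EuclideanSpace ℝ (Fin n)} (hx : x ∈ (extChartAt (𝓡 n) c).target)
    (hq : ι ((extChartAt (𝓡 n) c).symm x) ∈ (extChartAt (𝓡 (n + 1)) q).source) :
    ContDiffAt ℝ 3 (localMap ι c q) x := by
  have h1 := (hι.contMDiffAt (x := (extChartAt (𝓡 n) c).symm x)).comp x
    (contMDiffAt_extChartAt_symm hx)
  have h2 := contMDiffAt_extChartAt' (I := 𝓡 (n + 1)) (n := 3) (x := q)
    (x' := ι ((extChartAt (𝓡 n) c).symm x)) (by rwa [← extChartAt_source (𝓡 (n + 1))])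
  exact (h2.comp x h1).contDiffAt

theorem coordVec_push (hι : ContMDiff (𝓡 n) (𝓡 (n + 1)) 3 ι) {c : H} {q : M}
    {x : EuclideanSpace ℝ (Fin n)} (hx : x ∈ (extChartAt (𝓡 n) c).target)
    (hq : ι ((extChartAt (𝓡 n) c).symm x) ∈ (extChartAt (𝓡 (n + 1)) q).source)
    (w : EuclideanSpace ℝ (Fin n)) :
    coordVec q (ι ((extChartAt (𝓡 n) c).symm x))
      (push ι ((extChartAt (𝓡 n) c).symm x) (ofCoordVec c x w))
      = fderiv ℝ (localMap ι c q) x w := by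
  have h2 := (contMDiffAt_extChartAt' (I := 𝓡 (n + 1)) (n := 3) (x := q)
    (x' := ι ((extChartAt (𝓡 n) c).symm x))
    (by rwa [← extChartAt_source (𝓡 (n + 1))])).mdifferentiableAt (by norm_num)
  have h1 := (hι.contMDiffAt (x := (extChartAt (𝓡 n) c).symm x)).mdifferentiableAt (by norm_num)
  have h3 := mfderiv_ofCoordVec hx (h2.comp _ h1) w
  rw [mfderiv_comp _ h2 h1] at h3
  exact h3

theorem contMDiff_push (hι : ContMDiff (𝓡 n) (𝓡 (n + 1)) 3 ι)
    {E' H' N : Type*} [NormedAddCommGroup E'] [NormedSpace ℝ E']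
    [TopologicalSpace H'] {I' : ModelWithCorners ℝ E' H'} [TopologicalSpace N] [ChartedSpace H' N]
    {b : N → H} {l : ∀ y : N, TangentSpace (𝓡 n) (b y)} {y : N}
    (hl : ContMDiffAt I' (𝓡 n).tangent 1 (fun y => (⟨b y, l y⟩ : TangentBundle (𝓡 n) H)) y) :
    ContMDiffAt I' (𝓡 (n + 1)).tangent 1
      (fun y => (⟨ι (b y), push ι (b y) (l y)⟩ : TangentBundle (𝓡 (n + 1)) M)) y :=
  ((hι.contMDiff_tangentMap (m := 1) (by norm_num)).contMDiffAt
    (x := (⟨b y, l y⟩ : TangentBundle (𝓡 n) H))).comp y hl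

theorem coeffMatrix_transverseMetric (hι : ContMDiff (𝓡 n) (𝓡 (n + 1)) 3 ι) {c : H} {q : M}
    {x : EuclideanSpace ℝ (Fin n)} (hx : x ∈ (extChartAt (𝓡 n) c).target)
    (hq : ι ((extChartAt (𝓡 n) c).symm x) ∈ (extChartAt (𝓡 (n + 1)) q).source) (i j : Fin n) :
    coeffMatrix (transverseMetric g ι) c x i j
      = coeffForm g.metric q (localMap ι c q x) (fderiv ℝ (localMap ι c q) x (stdVec i))
        (fderiv ℝ (localMap ι c q) x (stdVec j)) := by
  rw [← coordVec_push hι hx hq, ← coordVec_push hι hx hq]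
  exact apply_eq_coeffForm g.metric hq _ _

theorem contDiffOn_coeffMatrix_transverseMetric (hι : ContMDiff (𝓡 n) (𝓡 (n + 1)) 3 ι) (c : H)
    (i j : Fin n) :
    ContDiffOn ℝ 1 (fun x => coeffMatrix (transverseMetric g ι) c x i j)
      (extChartAt (𝓡 n) c).target := by
  intro x hx
  have hn := (isOpen_extChartAt_target (I := 𝓡 n) c).mem_nhds hx
  have h1 := fun w => contMDiff_push hι (((contMDiffOn_ofCoordVec c w).contMDiffAt hn).of_le
    (show (1 : WithTop ℕ∞) ≤ 2 by norm_num))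
  exact (contMDiffAt_bilinear_apply (g.contMDiff.of_le (by norm_num)) (h1 (stdVec i))
    (h1 (stdVec j))).contDiffAt.contDiffWithinAt

/-- The covariant derivative along `ι` of a tangent field, in coordinates. -/
theorem coordVec_covDeriv (hι : ContMDiff (𝓡 n) (𝓡 (n + 1)) 3 ι)
    {l : ∀ p : H, TangentSpace (𝓡 n) p}
    (hl : ContMDiff (𝓡 n) (𝓡 n).tangent 1 fun p => (⟨p, l p⟩ : TangentBundle (𝓡 n) H))
    {c : H} {x : EuclideanSpace ℝ (Fin n)} (hx : x ∈ (extChartAt (𝓡 n) c).target) {q : M}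
    (hq : q = ι ((extChartAt (𝓡 n) c).symm x)) (w : EuclideanSpace ℝ (Fin n)) :
    coordVec q (ι ((extChartAt (𝓡 n) c).symm x))
      (covDeriv g ι (fun p => push ι p (l p)) ((extChartAt (𝓡 n) c).symm x) (ofCoordVec c x w))
      = fderiv ℝ (fun y => fderiv ℝ (localMap ι c q) y (fieldCoord c l y)) x w
        + g.christoffelMap q (localMap ι c q x) (fderiv ℝ (localMap ι c q) x w)
          (fderiv ℝ (localMap ι c q) x (fieldCoord c l x)) := by
  subst hq
  set p := (extChartAt (𝓡 n) c).symm x with hp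
  have hsrc : ι p ∈ (extChartAt (𝓡 (n + 1)) (ι p)).source := mem_extChartAt_source (ι p)
  have hN : ContMDiffAt (𝓡 n) 𝓘(ℝ, EuclideanSpace ℝ (Fin (n + 1))) 1
      (fun r => coordVec (ι p) (ι r) (push ι r (l r))) p :=
    contMDiffAt_coordVec (by norm_num) (contMDiff_push hι (hl.contMDiffAt (x := p))) hsrc
  have hev : (fun y => coordVec (ι p) (ι ((extChartAt (𝓡 n) c).symm y))
      (push ι ((extChartAt (𝓡 n) c).symm y) (l ((extChartAt (𝓡 n) c).symm y)))) =ᶠ[𝓝 x]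
      fun y => fderiv ℝ (localMap ι c (ι p)) y (fieldCoord c l y) := by
    filter_upwards [eventually_mem_chart hι.continuous hx hsrc] with y hy
    rw [← coordVec_push hι hy.1 hy.2, ofCoordVec_fieldCoord l hy.1]
  have hd := mfderiv_ofCoordVec hx (hN.mdifferentiableAt (by norm_num)) w
  rw [hev.fderiv_eq] at hd
  have e1 := coordVec_push hι hx hsrc w
  have e2 := coordVec_push hι hx hsrc (fieldCoord c l x)
  rw [ofCoordVec_fieldCoord l hx] at e2
  rw [coordVec_covDeriv_self _ _ _ _ hd, ← e1, ← e2]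
  rfl

end Hypersurface

/-! ### Positive definite fields of bilinear forms -/

section PosDef

variable {n : ℕ} {H : Type*} [TopologicalSpace H] [ChartedSpace (EuclideanSpace ℝ (Fin n)) H]
  [IsManifold (𝓡 n) 3 H]

/-- The matrix is positive definite, being the Gram matrix of the coordinate vectors, which are
independent because `coordVec` inverts `ofCoordVec`. -/
theorem det_coeffMatrix_pos
    {h : ∀ p : H, TangentSpace (𝓡 n) p →L[ℝ] TangentSpace (𝓡 n) p →L[ℝ] ℝ}
    (hsymm : ∀ p v w, h p v w = h p w v) (hpos : ∀ p v, v ≠ 0 → 0 < h p v v) {c : H}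
    {x : EuclideanSpace ℝ (Fin n)} (hx : x ∈ (extChartAt (𝓡 n) c).target) :
    0 < (coeffMatrix h c x).det := by
  refine Matrix.PosDef.det_pos (Matrix.PosDef.of_dotProduct_mulVec_pos ?_ ?_)
  · ext i j
    exact hsymm _ _ _
  · intro v hv
    have e : dotProduct (star v) ((coeffMatrix h c x).mulVec v)
        = coeffForm h c x (WithLp.toLp 2 v) (WithLp.toLp 2 v) := by
      rw [coeffForm_apply]
      simp only [dotProduct, Matrix.mulVec, Finset.mul_sum]
      exact Finset.sum_congr rfl fun i _ => Finset.sum_congr rfl fun j _ => by simp; ring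
    rw [e, coeffForm_eq]
    refine hpos _ _ fun h0 => hv ?_
    have h1 := coordVec_ofCoordVec hx (WithLp.toLp 2 v)
    rw [h0, coordVec_eq_coordMap, map_zero] at h1
    funext i
    simpa using (congrArg (fun z : EuclideanSpace ℝ (Fin n) => z i) h1).symm

theorem contDiffOn_sqrt_det {s : Set (EuclideanSpace ℝ (Fin n))}
    {A : EuclideanSpace ℝ (Fin n) → Matrix (Fin n) (Fin n) ℝ}
    (hA : ∀ i j, ContDiffOn ℝ 1 (fun x => A x i j) s) (hpos : ∀ x ∈ s, 0 < (A x).det) :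
    ContDiffOn ℝ 1 (fun x => √(A x).det) s := by
  refine ContDiffOn.sqrt ?_ fun x hx => (hpos x hx).ne'
  simp only [Matrix.det_apply]
  refine ContDiffOn.sum fun σ _ => ContDiffOn.const_smul _ ?_
  exact contDiffOn_prod fun i _ => hA _ _

end PosDef

/-! ### Horizons -/

section Push

variable {n : ℕ}
  {M : Type*} [TopologicalSpace M] [ChartedSpace (EuclideanSpace ℝ (Fin (n + 1))) M]
  {H : Type*} [TopologicalSpace H] [ChartedSpace (EuclideanSpace ℝ (Fin n)) H]
  {ι : H → M}

theorem push_smul (p : H) (r : ℝ) (v : TangentSpace (𝓡 n) p) :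
    push ι p (r • v) = r • push (n := n) (M := M) ι p v :=
  map_smul (mfderiv (𝓡 n) (𝓡 (n + 1)) ι p) r v

theorem push_zero (p : H) : push (n := n) (M := M) ι p 0 = 0 :=
  map_zero (mfderiv (𝓡 n) (𝓡 (n + 1)) ι p)

end Push

/-! ### The field of bilinear forms `g_T + α ⊗ α`. -/

section TildeMetric

variable {n : ℕ}
  {M : Type*} [TopologicalSpace M] [ChartedSpace (EuclideanSpace ℝ (Fin (n + 1))) M]
  [IsManifold (𝓡 (n + 1)) 4 M]
  {H : Type*} [TopologicalSpace H] [ChartedSpace (EuclideanSpace ℝ (Fin n)) H]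
  {g : Spacetime (n + 1) M} {ι : H → M}

theorem tildeMetric_apply (α : ∀ p : H, TangentSpace (𝓡 n) p →L[ℝ] ℝ) (p : H)
    (v w : TangentSpace (𝓡 n) p) :
    tildeMetric g ι α p v w = transverseMetric g ι p v w + α p v * α p w := rfl

theorem coeffMatrix_tildeMetric (α : ∀ p : H, TangentSpace (𝓡 n) p →L[ℝ] ℝ) (c : H)
    (x : EuclideanSpace ℝ (Fin n)) :
    coeffMatrix (tildeMetric g ι α) c x = coeffMatrix (transverseMetric g ι) c x
      + Matrix.vecMulVec (fun i => α _ (ofCoordVec c x (stdVec i)))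
        (fun i => α _ (ofCoordVec c x (stdVec i))) := rfl

theorem tildeMetric_symm (α : ∀ p : H, TangentSpace (𝓡 n) p →L[ℝ] ℝ) (p : H)
    (v w : TangentSpace (𝓡 n) p) : tildeMetric g ι α p v w = tildeMetric g ι α p w v := by
  rw [tildeMetric_apply, tildeMetric_apply, transverseMetric_symm, mul_comm (α p v)]

end TildeMetric

section Horizon

variable {n : ℕ}
  {M : Type*} [TopologicalSpace M] [ChartedSpace (EuclideanSpace ℝ (Fin (n + 1))) M]
  [IsManifold (𝓡 (n + 1)) 4 M]
  {H : Type*} [TopologicalSpace H] [ChartedSpace (EuclideanSpace ℝ (Fin n)) H]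
  [IsManifold (𝓡 n) 3 H]
  {g : Spacetime (n + 1) M} {ι : H → M} {l : ∀ p : H, TangentSpace (𝓡 n) p}

namespace IsHorizon

theorem push_ne_zero (hι : IsHorizon g ι) {p : H} {v : TangentSpace (𝓡 n) p} (hv : v ≠ 0) :
    push (n := n) (M := M) ι p v ≠ 0 := fun h =>
  hv (hι.injective_mfderiv p (h.trans (push_zero p).symm))

/-- A lightlike vector tangent to a null hypersurface is orthogonal to it. -/
theorem metric_push_eq_zero (hι : IsHorizon g ι) (hl : IsLightlikeField g ι l) (p : H)
    (w : TangentSpace (𝓡 n) p) : g.metric (ι p) (push ι p (l p)) (push ι p w) = 0 := by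
  obtain ⟨v, hv, hvw⟩ := hι.null p
  -- The degenerate direction `v` is null and orthogonal to `l`. As `l` is null too, it is a
  -- multiple of `v` and inherits its orthogonality to `H`.
  obtain ⟨r, hr⟩ := (Spacetime.nonneg_of_orthogonal (hι.push_ne_zero hv) (hvw v) (hvw (l p))).2
    (hl.future p).2.1
  have hr' : push ι p (l p) = r • push ι p v := hr
  have := hvw w
  rw [transverseMetric_apply] at this
  rw [hr']
  simp [this]

/-- Tangent vectors are orthogonal to the null vector `l`, so they are spacelike or multiples of
`l`; on multiples of `l` the term `α ⊗ α` is positive because `α(l) = 1`. -/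
theorem tildeMetric_pos (hι : IsHorizon g ι) (hl : IsLightlikeField g ι l)
    {α : ∀ p : H, TangentSpace (𝓡 n) p →L[ℝ] ℝ} (hα : ∀ p, α p (l p) = 1) (p : H)
    (v : TangentSpace (𝓡 n) p) (hv : v ≠ 0) : 0 < tildeMetric g ι α p v v := by
  have h := Spacetime.nonneg_of_orthogonal (hl.future p).1 (hl.future p).2.1
    (hι.metric_push_eq_zero hl p v)
  rw [tildeMetric_apply, transverseMetric_apply]
  rcases h.1.lt_or_eq with h1 | h1
  · exact add_pos_of_pos_of_nonneg h1 (mul_self_nonneg _)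
  · obtain ⟨r, hr⟩ := h.2 h1.symm
    rw [← push_smul] at hr
    have hvr : v = r • l p := hι.injective_mfderiv p hr
    rw [← h1, zero_add, hvr, map_smul, hα, smul_eq_mul, mul_one]
    refine mul_self_pos.2 fun h0 => hv ?_
    rw [hvr, h0, zero_smul]

theorem isConnectionForm_connectionForm (hι : IsHorizon g ι) (hl : IsLightlikeField g ι l) :
    IsConnectionForm g ι l (connectionForm g ι l) := by
  unfold connectionForm
  rw [dif_pos (hι.totallyGeodesic l hl)]
  exact (hι.totallyGeodesic l hl).choose_spec

/-- The Lie derivative of the induced metric along a lightlike field vanishes. -/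
theorem lieDerivative_coeffMatrix (hι : IsHorizon g ι) (hl : IsLightlikeField g ι l) {c : H}
    {x : EuclideanSpace ℝ (Fin n)} (hx : x ∈ (extChartAt (𝓡 n) c).target) (i j : Fin n) :
    fderiv ℝ (fun y => coeffMatrix (transverseMetric g ι) c y i j) x (fieldCoord c l x)
      + ∑ k, fderiv ℝ (fieldCoord c l) x (EuclideanSpace.single i 1) k
        * coeffMatrix (transverseMetric g ι) c x k j
      + ∑ k, fderiv ℝ (fieldCoord c l) x (EuclideanSpace.single j 1) k
        * coeffMatrix (transverseMetric g ι) c x i k = 0 := by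
  obtain ⟨ω, hω⟩ := hι.totallyGeodesic l hl
  set q := ι ((extChartAt (𝓡 n) c).symm x) with hq
  have hsrc : q ∈ (extChartAt (𝓡 (n + 1)) q).source := mem_extChartAt_source q
  have htgt : localMap ι c q x ∈ (extChartAt (𝓡 (n + 1)) q).target :=
    (extChartAt (𝓡 (n + 1)) q).map_source hsrc
  have hopen := (isOpen_extChartAt_target (I := 𝓡 n) c).mem_nhds hx
  -- Total geodesy: the covariant derivative of `l` is a multiple of `l`, which is orthogonal to all
  -- vectors tangent to `H`.
  have hort : ∀ X Y, coeffForm g.metric q (localMap ι c q x)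
      (fderiv ℝ (fun y => fderiv ℝ (localMap ι c q) y (fieldCoord c l y)) x X
        + g.christoffelMap q (localMap ι c q x) (fderiv ℝ (localMap ι c q) x X)
          (fderiv ℝ (localMap ι c q) x (fieldCoord c l x)))
      (fderiv ℝ (localMap ι c q) x Y) = 0 := by
    intro X Y
    rw [← coordVec_covDeriv hι.contMDiff hl.contMDiff hx hq X, ← coordVec_push hι.contMDiff hx hsrc Y,
      hω, coordVec_smul]
    simp only [map_smul, smul_apply]
    rw [← show _ = coeffForm g.metric q (localMap ι c q x) _ _ from apply_eq_coeffForm g.metric hsrc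
      (push ι ((extChartAt (𝓡 n) c).symm x) (l ((extChartAt (𝓡 n) c).symm x)))
      (push ι ((extChartAt (𝓡 n) c).symm x) (ofCoordVec c x Y)), hι.metric_push_eq_zero hl,
      smul_zero]
  have key := lieDerivative_pullback_eq_zero
    ((contDiffAt_localMap hι.contMDiff hx hsrc).of_le (by norm_num))
    (g.differentiableAt_coeffForm htgt) (Filter.Eventually.of_forall (g.coeffForm_symm q))
    (((contDiffOn_fieldCoord hl.contMDiff).contDiffAt hopen).differentiableAt (by norm_num))
    (g.christoffelMap q (localMap ι c q x)) (g.coeffForm_christoffelMap htgt) hort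
    (stdVec i) (stdVec j)
  have hev : (fun y => coeffMatrix (transverseMetric g ι) c y i j) =ᶠ[𝓝 x] fun y =>
      coeffForm g.metric q (localMap ι c q y) (fderiv ℝ (localMap ι c q) y (stdVec i))
        (fderiv ℝ (localMap ι c q) y (stdVec j)) := by
    filter_upwards [eventually_mem_chart hι.contMDiff.continuous hx hsrc] with y hy
    exact coeffMatrix_transverseMetric hι.contMDiff hy.1 hy.2 i j
  rw [← key, hev.fderiv_eq]
  simp_rw [coeffMatrix_transverseMetric hι.contMDiff hx hsrc]
  congr 1
  · congr 1
    conv_rhs => rw [eq_sum_stdVec (fderiv ℝ (fieldCoord c l) x (stdVec i))]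
    simp [sum_apply, stdVec]
  · conv_rhs => rw [eq_sum_stdVec (fderiv ℝ (fieldCoord c l) x (stdVec j))]
    simp [stdVec]

theorem _root_.NullHorizon.IsC1Form.contDiffOn_coeff
    {α : ∀ p : H, TangentSpace (𝓡 n) p →L[ℝ] ℝ} (hα : IsC1Form α) (c : H)
    (w : EuclideanSpace ℝ (Fin n)) :
    ContDiffOn ℝ 1 (fun x => α ((extChartAt (𝓡 n) c).symm x) (ofCoordVec c x w))
      (extChartAt (𝓡 n) c).target := by
  intro x hx
  have hn := (isOpen_extChartAt_target (I := 𝓡 n) c).mem_nhds hx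
  exact (contMDiffAt_linear_apply hα (((contMDiffOn_ofCoordVec c w).contMDiffAt hn).of_le
    (show (1 : WithTop ℕ∞) ≤ 2 by norm_num))).contDiffAt.contDiffWithinAt

theorem contDiffOn_coeffMatrix_tildeMetric (hι : IsHorizon g ι)
    {α : ∀ p : H, TangentSpace (𝓡 n) p →L[ℝ] ℝ} (hα : IsC1Form α) (c : H) (i j : Fin n) :
    ContDiffOn ℝ 1 (fun x => coeffMatrix (tildeMetric g ι α) c x i j)
      (extChartAt (𝓡 n) c).target :=
  (contDiffOn_coeffMatrix_transverseMetric hι.contMDiff c i j).add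
    ((hα.contDiffOn_coeff c _).mul (hα.contDiffOn_coeff c _))

/-- A lightlike field `l` with `α(l) = 1` is divergence free for the metric `g_T + α ⊗ α`. -/
theorem divergence_eq_zero (hι : IsHorizon g ι) (hl : IsLightlikeField g ι l)
    {α : ∀ p : H, TangentSpace (𝓡 n) p →L[ℝ] ℝ} (hα : IsC1Form α) (hαl : ∀ p, α p (l p) = 1)
    {c : H} {x : EuclideanSpace ℝ (Fin n)} (hx : x ∈ (extChartAt (𝓡 n) c).target) :
    fderiv ℝ (fun y => √(coeffMatrix (tildeMetric g ι α) c y).det) x (fieldCoord c l x)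
      + √(coeffMatrix (tildeMetric g ι α) c x).det
        * ∑ i, fderiv ℝ (fieldCoord c l) x (EuclideanSpace.single i 1) i = 0 := by
  have hopen := (isOpen_extChartAt_target (I := 𝓡 n) c).mem_nhds hx
  have hdet := det_coeffMatrix_pos (tildeMetric_symm (g := g) (ι := ι) α)
    (hι.tildeMetric_pos hl hαl) hx
  simp only [coeffMatrix_tildeMetric] at hdet ⊢
  refine fderiv_sqrt_det_add_trace
    (h := fun y => coeffMatrix (transverseMetric g ι) c y)
    (a := fun y i => α _ (ofCoordVec c y (stdVec i))) (v := fieldCoord c l)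
    (fun i j => ((contDiffOn_coeffMatrix_transverseMetric hι.contMDiff c i j).contDiffAt
      hopen).differentiableAt (by norm_num))
    (fun i => ((hα.contDiffOn_coeff c _).contDiffAt hopen).differentiableAt (by norm_num))
    (((contDiffOn_fieldCoord hl.contMDiff).contDiffAt hopen).differentiableAt (by norm_num))
    (fun i j => transverseMetric_symm _ _ _) (fun j => ?_) ?_ hdet
    (hι.lieDerivative_coeffMatrix hl hx)
  · have h0 := hι.metric_push_eq_zero hl _ (ofCoordVec c x (stdVec j))
    rw [← transverseMetric_apply, ← ofCoordVec_fieldCoord l hx, ofCoordVec_eq_sum] at h0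
    simp only [map_sum, map_smul, sum_apply, smul_apply, smul_eq_mul] at h0
    exact h0
  · filter_upwards [hopen] with y hy
    have h1 := hαl ((extChartAt (𝓡 n) c).symm y)
    rw [← ofCoordVec_fieldCoord l hy, ofCoordVec_eq_sum] at h1
    simp only [map_sum, map_smul, smul_eq_mul] at h1
    rw [← h1]
    exact Finset.sum_congr rfl fun i _ => mul_comm _ _

end IsHorizon

end Horizon

/-! ### The Riemannian measure in a chart -/

section ChangeOfChart

variable {n : ℕ} {H : Type*} [TopologicalSpace H] [ChartedSpace (EuclideanSpace ℝ (Fin n)) H]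
  [IsManifold (𝓡 n) 3 H]
  (h : ∀ p : H, TangentSpace (𝓡 n) p →L[ℝ] TangentSpace (𝓡 n) p →L[ℝ] ℝ)

/-- The transformation of the volume density under a change of charts. -/
theorem sqrt_det_coeffMatrix_eq {c c' : H} {x : EuclideanSpace ℝ (Fin n)}
    (hx : x ∈ (extChartAt (𝓡 n) c).target)
    (hx' : (extChartAt (𝓡 n) c).symm x ∈ (extChartAt (𝓡 n) c').source) :
    √(coeffMatrix h c x).det
      = |(fderiv ℝ (fun y => extChartAt (𝓡 n) c' ((extChartAt (𝓡 n) c).symm y)) x).det| *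
        √(coeffMatrix h c' (extChartAt (𝓡 n) c' ((extChartAt (𝓡 n) c).symm x))).det := by
  set L := fderiv ℝ (fun y => extChartAt (𝓡 n) c' ((extChartAt (𝓡 n) c).symm y)) x with hL
  set p := (extChartAt (𝓡 n) c).symm x with hp
  set b := (EuclideanSpace.basisFun (Fin n) ℝ).toBasis with hb
  set J := LinearMap.toMatrix b b (L : EuclideanSpace ℝ (Fin n) →ₗ[ℝ] EuclideanSpace ℝ (Fin n))
    with hJdef
  have hJ : ∀ k i, J k i = L (stdVec i) k := by
    intro k i
    simp [hJdef, hb, LinearMap.toMatrix_apply, stdVec]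
  have hd : MDifferentiableAt (𝓡 n) 𝓘(ℝ, EuclideanSpace ℝ (Fin n)) (extChartAt (𝓡 n) c') p :=
    (contMDiffAt_extChartAt' (I := 𝓡 n) (n := 3) (x := c') (x' := p)
      (by rwa [← extChartAt_source (𝓡 n)])).mdifferentiableAt (by norm_num)
  have hcoord : ∀ w, coordVec c' p (ofCoordVec c x w) = L w := fun w => mfderiv_ofCoordVec hx hd w
  -- The matrices are congruent through the Jacobian `J` of the transition map; the determinant
  -- acquires a factor `(det J)²`, its square root `|det J|`.
  have hmat : coeffMatrix h c x
      = J.transpose * coeffMatrix h c' (extChartAt (𝓡 n) c' p) * J := by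
    ext i j
    have h1 : coeffMatrix h c x i j = coeffForm h c' (extChartAt (𝓡 n) c' p) (L (stdVec i))
        (L (stdVec j)) := by
      rw [← hcoord, ← hcoord]
      exact apply_eq_coeffForm h hx' _ _
    rw [h1, coeffForm_apply, Finset.sum_comm]
    simp only [Matrix.mul_apply, Matrix.transpose_apply, hJ, Finset.sum_mul]
    exact Finset.sum_congr rfl fun k _ => Finset.sum_congr rfl fun l _ => by ring
  have hdet : J.det = L.det := LinearMap.det_toMatrix b _
  rw [hmat, Matrix.det_mul, Matrix.det_mul, Matrix.det_transpose, hdet, mul_right_comm,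
    Real.sqrt_mul (mul_self_nonneg _), Real.sqrt_mul_self_eq_abs]

end ChangeOfChart

section Measure

variable {n : ℕ} {H : Type*} [TopologicalSpace H] [ChartedSpace (EuclideanSpace ℝ (Fin n)) H]

theorem measurableSet_extChartAt_target (c : H) : MeasurableSet (extChartAt (𝓡 n) c).target :=
  (isOpen_extChartAt_target (I := 𝓡 n) c).measurableSet

variable [MeasurableSpace H] [BorelSpace H]

theorem measurableSet_extChartAt_source (c : H) : MeasurableSet (extChartAt (𝓡 n) c).source :=
  (isOpen_extChartAt_source (I := 𝓡 n) c).measurableSet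

theorem aemeasurable_extChartAt_symm (c : H) :
    AEMeasurable (extChartAt (𝓡 n) c).symm (volume.restrict (extChartAt (𝓡 n) c).target) :=
  (continuousOn_extChartAt_symm c).aemeasurable (measurableSet_extChartAt_target c)

/-- The inverse chart is continuous only on its target, so the preimage is taken in that subtype and
then included in the whole space. -/
theorem measurableSet_preimage_extChartAt_symm_inter (c : H) {A : Set H} (hA : MeasurableSet A) :
    MeasurableSet ((extChartAt (𝓡 n) c).symm ⁻¹' A ∩ (extChartAt (𝓡 n) c).target) := by
  have h1 : Measurable ((extChartAt (𝓡 n) c).target.domRestrict (extChartAt (𝓡 n) c).symm) :=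
    (continuousOn_extChartAt_symm c).domRestrict.measurable
  have h2 := (measurableSet_extChartAt_target c).subtype_image (h1 hA)
  convert h2 using 1
  ext x
  simp only [mem_inter_iff, mem_preimage, mem_image, Subtype.exists]
  constructor
  · rintro ⟨h1, h2⟩; exact ⟨x, h2, h1, rfl⟩
  · rintro ⟨y, h2, h1, rfl⟩; exact ⟨h1, h2⟩

variable (h : ∀ p : H, TangentSpace (𝓡 n) p →L[ℝ] TangentSpace (𝓡 n) p →L[ℝ] ℝ)

theorem chartMeasure_apply (c : H) {A : Set H} (hA : MeasurableSet A) :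
    chartMeasure h c A = ∫⁻ x in (extChartAt (𝓡 n) c).symm ⁻¹' A ∩ (extChartAt (𝓡 n) c).target,
      ENNReal.ofReal √(coeffMatrix h c x).det := by
  unfold chartMeasure
  rw [Measure.map_apply_of_aemeasurable
    ((aemeasurable_extChartAt_symm c).mono_ac (withDensity_absolutelyContinuous _ _)) hA,
    withDensity_apply', Measure.restrict_restrict' (measurableSet_extChartAt_target c)]

variable [IsManifold (𝓡 n) 3 H]

/-- The measures of two charts agree on the intersection of their domains. -/
theorem chartMeasure_eq_chartMeasure (c c' : H) {A : Set H} (hA : MeasurableSet A)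
    (hc : A ⊆ (extChartAt (𝓡 n) c).source) (hc' : A ⊆ (extChartAt (𝓡 n) c').source) :
    chartMeasure h c A = chartMeasure h c' A := by
  rw [chartMeasure_apply h c hA, chartMeasure_apply h c' hA]
  set U := (extChartAt (𝓡 n) c).symm ⁻¹' A ∩ (extChartAt (𝓡 n) c).target with hU
  set τ := fun y => extChartAt (𝓡 n) c' ((extChartAt (𝓡 n) c).symm y) with hτ
  have himg : (extChartAt (𝓡 n) c').symm ⁻¹' A ∩ (extChartAt (𝓡 n) c').target = τ '' U := by
    ext y
    constructor
    · rintro ⟨h1, h2⟩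
      refine ⟨extChartAt (𝓡 n) c ((extChartAt (𝓡 n) c').symm y), ⟨?_, ?_⟩, ?_⟩
      · rw [mem_preimage, (extChartAt (𝓡 n) c).left_inv (hc h1)]
        exact h1
      · exact (extChartAt (𝓡 n) c).map_source (hc h1)
      · simp only [hτ]
        rw [(extChartAt (𝓡 n) c).left_inv (hc h1), (extChartAt (𝓡 n) c').right_inv h2]
    · rintro ⟨x, ⟨h1, h2⟩, rfl⟩
      refine ⟨?_, (extChartAt (𝓡 n) c').map_source (hc' h1)⟩
      rw [mem_preimage, (extChartAt (𝓡 n) c').left_inv (hc' h1)]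
      exact h1
  have hinj : InjOn τ U := by
    rintro x ⟨h1, h2⟩ y ⟨h3, h4⟩ hxy
    exact (extChartAt (𝓡 n) c).symm.injOn h2 h4
      ((extChartAt (𝓡 n) c').injOn (hc' h1) (hc' h3) hxy)
  have hder : ∀ x ∈ U, HasFDerivWithinAt τ (fderiv ℝ τ x) U x := by
    rintro x ⟨h1, h2⟩
    have e1 := contMDiffAt_extChartAt_symm (c := c) h2
    have e2 := contMDiffAt_extChartAt' (I := 𝓡 n) (n := 3) (x := c')
      (x' := (extChartAt (𝓡 n) c).symm x) (by rw [← extChartAt_source (𝓡 n)]; exact hc' h1)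
    exact ((e2.comp x e1).contDiffAt.differentiableAt (by norm_num)).hasFDerivAt.hasFDerivWithinAt
  have hUm : MeasurableSet U := measurableSet_preimage_extChartAt_symm_inter c hA
  rw [himg, lintegral_image_eq_lintegral_abs_det_fderiv_mul volume hUm hder hinj]
  refine setLIntegral_congr_fun hUm fun x hx => ?_
  rw [sqrt_det_coeffMatrix_eq h hx.2 (hc' hx.1), ENNReal.ofReal_mul (abs_nonneg _)]

variable [SigmaCompactSpace H] [Nonempty H]

/-- Independence of the decomposition chosen in `riemannianMeasure`: on each piece the two chart
measures agree, and countable additivity reassembles `A`. -/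
theorem riemannianMeasure_apply (c : H) {A : Set H} (hA : MeasurableSet A)
    (hc : A ⊆ (extChartAt (𝓡 n) c).source) :
    riemannianMeasure h A = chartMeasure h c A := by
  unfold riemannianMeasure
  set e := (exists_chart_cover n H).choose with he
  have hcov := (exists_chart_cover n H).choose_spec
  rw [← he] at hcov
  set D := disjointed fun j => (extChartAt (𝓡 n) (e j)).source with hD
  have hDm : ∀ k, MeasurableSet (D k) :=
    MeasurableSet.disjointed fun j => measurableSet_extChartAt_source (e j)
  rw [Measure.sum_apply _ hA]
  have hk : ∀ k, (chartMeasure h (e k)).restrict (D k) A = chartMeasure h c (A ∩ D k) := by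
    intro k
    rw [Measure.restrict_apply hA]
    exact chartMeasure_eq_chartMeasure h _ _ (hA.inter (hDm k))
      (inter_subset_right.trans (disjointed_subset _ k)) (inter_subset_left.trans hc)
  simp_rw [hk]
  rw [← measure_iUnion _ fun k => hA.inter (hDm k), ← inter_iUnion, hD, iUnion_disjointed, hcov,
    inter_univ]
  intro i j hij
  exact (disjoint_disjointed _ hij).mono inter_subset_right inter_subset_right

theorem riemannianMeasure_restrict_source (c : H) :
    (riemannianMeasure h).restrict (extChartAt (𝓡 n) c).source = chartMeasure h c := by
  ext A hA
  have hS := measurableSet_extChartAt_source (n := n) c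
  rw [Measure.restrict_apply hA, riemannianMeasure_apply h c (hA.inter hS) inter_subset_right,
    chartMeasure_apply h c hA, chartMeasure_apply h c (hA.inter hS)]
  congr 2
  ext x
  simp only [mem_inter_iff, mem_preimage]
  constructor
  · rintro ⟨⟨h1, -⟩, h2⟩; exact ⟨h1, h2⟩
  · rintro ⟨h1, h2⟩; exact ⟨⟨h1, (extChartAt (𝓡 n) c).map_target h2⟩, h2⟩

variable {h}

theorem setIntegral_source_riemannianMeasure {c : H}
    (hρ : ContinuousOn (fun x => √(coeffMatrix h c x).det) (extChartAt (𝓡 n) c).target)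
    {F : H → ℝ} (hF : Measurable F) :
    ∫ p in (extChartAt (𝓡 n) c).source, F p ∂(riemannianMeasure h)
      = ∫ x in (extChartAt (𝓡 n) c).target,
        √(coeffMatrix h c x).det * F ((extChartAt (𝓡 n) c).symm x) := by
  rw [riemannianMeasure_restrict_source]
  unfold chartMeasure
  rw [integral_map ((aemeasurable_extChartAt_symm c).mono_ac
      (withDensity_absolutelyContinuous _ _)) hF.aestronglyMeasurable,
    integral_withDensity_eq_integral_toReal_smul₀ _ (by simp)]
  · refine integral_congr_ae (Filter.Eventually.of_forall fun x => ?_)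
    simp [ENNReal.toReal_ofReal (Real.sqrt_nonneg _)]
  · exact (hρ.aemeasurable (measurableSet_extChartAt_target c)).ennreal_ofReal

/-- Each point has a neighbourhood mapped by its chart into a compact part of the target, where the
continuous density is integrable; compactness of `H` concludes. -/
theorem isFiniteMeasure_riemannianMeasure [CompactSpace H]
    (hρ : ∀ c, ContinuousOn (fun x => √(coeffMatrix h c x).det) (extChartAt (𝓡 n) c).target) :
    IsFiniteMeasure (riemannianMeasure h) := by
  refine ⟨isCompact_univ.measure_lt_top_of_nhdsWithin fun p _ => ?_⟩
  rw [nhdsWithin_univ]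
  set e := extChartAt (𝓡 n) p with he
  have hT := (isOpen_extChartAt_target (I := 𝓡 n) p).mem_nhds (mem_extChartAt_target p)
  obtain ⟨K, hK, hKT, hKc⟩ := local_compact_nhds hT
  set U := e.source ∩ e ⁻¹' (interior K) with hU
  have hUo : IsOpen U :=
    (continuousOn_extChartAt p).isOpen_inter_preimage (isOpen_extChartAt_source p) isOpen_interior
  refine ⟨U, hUo.mem_nhds ⟨mem_extChartAt_source p, mem_interior_iff_mem_nhds.2 hK⟩, ?_⟩
  rw [riemannianMeasure_apply h p hUo.measurableSet inter_subset_left,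
    chartMeasure_apply h p hUo.measurableSet]
  refine lt_of_le_of_lt (lintegral_mono_set (t := K) ?_)
    (((hρ p).mono hKT).integrableOn_compact hKc).lintegral_lt_top
  rintro x ⟨⟨-, h1⟩, h2⟩
  have h3 := interior_subset h1
  rwa [e.right_inv h2] at h3

/-- The density is positive on the chart target, a nonempty open set, which has positive Lebesgue
measure. -/
theorem riemannianMeasure_ne_zero
    (hpos : ∀ c : H, ∀ x ∈ (extChartAt (𝓡 n) c).target, 0 < (coeffMatrix h c x).det)
    (hρ : ∀ c, ContinuousOn (fun x => √(coeffMatrix h c x).det) (extChartAt (𝓡 n) c).target) :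
    riemannianMeasure h ≠ 0 := by
  intro h0
  obtain ⟨c⟩ := ‹Nonempty H›
  have hS := measurableSet_extChartAt_source (n := n) c
  have h1 := riemannianMeasure_apply h c hS subset_rfl
  have hsub : (extChartAt (𝓡 n) c).target
      ⊆ (extChartAt (𝓡 n) c).symm ⁻¹' (extChartAt (𝓡 n) c).source :=
    fun x hx => (extChartAt (𝓡 n) c).map_target hx
  rw [h0, chartMeasure_apply h c hS, inter_eq_right.2 hsub] at h1
  have h2 := (lintegral_eq_zero_iff'
    ((hρ c).aemeasurable (measurableSet_extChartAt_target c)).ennreal_ofReal).1 h1.symm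
  rw [Filter.EventuallyEq, ae_restrict_iff' (measurableSet_extChartAt_target c)] at h2
  have h3 : volume (extChartAt (𝓡 n) c).target = 0 := by
    refine measure_mono_null (fun x hx => ?_) h2
    simp only [mem_compl_iff, mem_ofPred_eq, not_forall]
    refine ⟨hx, ?_⟩
    simp only [Pi.zero_apply, ENNReal.ofReal_eq_zero, not_le]
    exact Real.sqrt_pos.2 (hpos c x hx)
  exact (isOpen_extChartAt_target (I := 𝓡 n) c).measure_ne_zero volume
    ⟨_, mem_extChartAt_target c⟩ h3

end Measure

/-! ### The divergence theorem -/

section Bump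

variable {n : ℕ} {H : Type*} [TopologicalSpace H] [ChartedSpace (EuclideanSpace ℝ (Fin n)) H]
  [IsManifold (𝓡 n) 3 H] [T2Space H]

/-- A bump function is smooth in its own chart, but on a `C^3` manifold this gives only class `C^3`.
-/
theorem contMDiff_smoothBumpFunction {c : H} (ψ : SmoothBumpFunction (𝓡 n) c) :
    ContMDiff (𝓡 n) 𝓘(ℝ) 3 ψ := by
  refine contMDiff_of_tsupport fun x hx => ?_
  have hx' : x ∈ (chartAt (EuclideanSpace ℝ (Fin n)) c).source :=
    ψ.tsupport_subset_chartAt_source hx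
  refine ContMDiffAt.congr_of_eventuallyEq ?_ (ψ.eqOn_source.eventuallyEq_of_mem <|
    (chartAt (EuclideanSpace ℝ (Fin n)) c).open_source.mem_nhds hx')
  exact ψ.contDiffAt.contMDiffAt.comp _ (contMDiffAt_extChartAt' hx')

end Bump

section Divergence

variable {n : ℕ} {H : Type*} [TopologicalSpace H] [ChartedSpace (EuclideanSpace ℝ (Fin n)) H]
  {l : ∀ p : H, TangentSpace (𝓡 n) p}

/-- The derivative of the function `u` along the vector field `l`. -/
def dirDeriv (l : ∀ p : H, TangentSpace (𝓡 n) p) (u : H → ℝ) (p : H) : ℝ :=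
  mfderiv (𝓡 n) 𝓘(ℝ) u p (l p)

theorem dirDeriv_add {u v : H → ℝ} (hu : ContMDiff (𝓡 n) 𝓘(ℝ) 1 u)
    (hv : ContMDiff (𝓡 n) 𝓘(ℝ) 1 v) (p : H) :
    dirDeriv l (fun q => u q + v q) p = dirDeriv l u p + dirDeriv l v p := by
  have h := ((hu.contMDiffAt (x := p)).mdifferentiableAt (by norm_num)).hasMFDerivAt.add
    ((hv.contMDiffAt (x := p)).mdifferentiableAt (by norm_num)).hasMFDerivAt
  exact congrArg (fun L => L (l p)) h.mfderiv

theorem dirDeriv_eq_zero_of_notMem_tsupport {u : H → ℝ} {p : H} (hp : p ∉ tsupport u) :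
    dirDeriv l u p = 0 := by
  have h1 := notMem_tsupport_iff_eventuallyEq.1 hp
  have h2 : HasMFDerivAt (𝓡 n) 𝓘(ℝ) u p (0 : TangentSpace (𝓡 n) p →L[ℝ] ℝ) :=
    (hasMFDerivAt_const (0 : ℝ) p).congr_of_eventuallyEq h1
  exact congrArg (fun L => L (l p)) h2.mfderiv

theorem fieldCoord_smul {l' : ∀ p : H, TangentSpace (𝓡 n) p}
    {F : H → ℝ} (hf : ∀ p, l' p = F p • l p) (c : H) (x : EuclideanSpace ℝ (Fin n)) :
    fieldCoord c l' x = F ((extChartAt (𝓡 n) c).symm x) • fieldCoord c l x := by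
  unfold fieldCoord
  rw [hf, coordVec_smul]

variable [IsManifold (𝓡 n) 3 H]

theorem continuous_dirDeriv
    (hl : ContMDiff (𝓡 n) (𝓡 n).tangent 1 fun p => (⟨p, l p⟩ : TangentBundle (𝓡 n) H))
    {u : H → ℝ} (hu : ContMDiff (𝓡 n) 𝓘(ℝ) 1 u) : Continuous (dirDeriv l u) :=
  ((contMDiff_snd_tangentBundle_modelSpace ℝ 𝓘(ℝ) (n := 1)).continuous.comp
    (hu.continuous_tangentMap le_rfl)).comp hl.continuous

theorem dirDeriv_symm {c : H} {x : EuclideanSpace ℝ (Fin n)}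
    (hx : x ∈ (extChartAt (𝓡 n) c).target) {u : H → ℝ} (hu : ContMDiff (𝓡 n) 𝓘(ℝ) 1 u) :
    dirDeriv l u ((extChartAt (𝓡 n) c).symm x)
      = fderiv ℝ (fun y => u ((extChartAt (𝓡 n) c).symm y)) x (fieldCoord c l x) := by
  rw [← mfderiv_ofCoordVec hx ((hu.contMDiffAt).mdifferentiableAt (by norm_num)),
    ofCoordVec_fieldCoord l hx]
  rfl

variable [CompactSpace H] [Nonempty H] [MeasurableSpace H] [BorelSpace H]
  {h : ∀ p : H, TangentSpace (𝓡 n) p →L[ℝ] TangentSpace (𝓡 n) p →L[ℝ] ℝ}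

theorem integral_dirDeriv_eq_zero_of_tsupport_subset
    (hl : ContMDiff (𝓡 n) (𝓡 n).tangent 1 fun p => (⟨p, l p⟩ : TangentBundle (𝓡 n) H)) {c : H}
    (hρ : ContDiffOn ℝ 1 (fun x => √(coeffMatrix h c x).det) (extChartAt (𝓡 n) c).target)
    (hdiv : ∀ x ∈ (extChartAt (𝓡 n) c).target,
      fderiv ℝ (fun y => √(coeffMatrix h c y).det) x (fieldCoord c l x)
        + √(coeffMatrix h c x).det
          * ∑ i, fderiv ℝ (fieldCoord c l) x (EuclideanSpace.single i 1) i = 0)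
    {u : H → ℝ} (hu : ContMDiff (𝓡 n) 𝓘(ℝ) 1 u)
    (hsub : tsupport u ⊆ (extChartAt (𝓡 n) c).source) :
    ∫ p, dirDeriv l u p ∂(riemannianMeasure h) = 0 := by
  set e := extChartAt (𝓡 n) c with he
  have hT : IsOpen e.target := isOpen_extChartAt_target (I := 𝓡 n) c
  rw [← setIntegral_eq_integral_of_forall_compl_eq_zero (s := e.source) fun p hp =>
      dirDeriv_eq_zero_of_notMem_tsupport fun hp' => hp (hsub hp'),
    setIntegral_source_riemannianMeasure hρ.continuousOn (continuous_dirDeriv hl hu).measurable]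
  -- Extension by zero, since the values of the inverse chart outside its target are meaningless.
  set w : EuclideanSpace ℝ (Fin n) → ℝ := e.target.indicator fun x => u (e.symm x) with hw
  have hwu : EqOn w (fun x => u (e.symm x)) e.target := fun x hx => indicator_of_mem hx _
  have hK : IsCompact (e '' tsupport u) :=
    (isClosed_tsupport u).isCompact.image_of_continuousOn ((continuousOn_extChartAt c).mono hsub)
  have hsupp : Function.support w ⊆ e '' tsupport u := by
    intro x hx
    have hxT : x ∈ e.target := by
      by_contra h0
      exact hx (indicator_of_notMem h0 _)
    rw [Function.mem_support, hwu hxT] at hx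
    exact ⟨e.symm x, subset_tsupport u hx, e.right_inv hxT⟩
  have hts : tsupport w ⊆ e '' tsupport u := closure_minimal hsupp hK.isClosed
  have hKT : e '' tsupport u ⊆ e.target := by
    rintro _ ⟨p, hp, rfl⟩
    exact e.map_source (hsub hp)
  have hwC : ContDiffOn ℝ 1 w e.target := by
    refine ContDiffOn.congr (fun x hx => ?_) hwu
    exact ((hu.contMDiffAt.comp x ((contMDiffAt_extChartAt_symm hx).of_le
      (by norm_num))).contDiffAt).contDiffWithinAt
  rw [← integral_fderiv_mul_eq_zero hT hρ (contDiffOn_fieldCoord hl) hwC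
    (HasCompactSupport.of_support_subset_isCompact hK hsupp) (hts.trans hKT) hdiv]
  refine setIntegral_congr_fun hT.measurableSet fun x hx => ?_
  have hev : w =ᶠ[𝓝 x] fun x => u (e.symm x) := hwu.eventuallyEq_of_mem (hT.mem_nhds hx)
  simp only [he, dirDeriv_symm hx hu, hev.fderiv_eq]

/-- The integral of the derivative of a function along a divergence free field vanishes. -/
theorem integral_dirDeriv_eq_zero [T2Space H]
    (hl : ContMDiff (𝓡 n) (𝓡 n).tangent 1 fun p => (⟨p, l p⟩ : TangentBundle (𝓡 n) H))
    (hρ : ∀ c, ContDiffOn ℝ 1 (fun x => √(coeffMatrix h c x).det) (extChartAt (𝓡 n) c).target)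
    (hdiv : ∀ c, ∀ x ∈ (extChartAt (𝓡 n) c).target,
      fderiv ℝ (fun y => √(coeffMatrix h c y).det) x (fieldCoord c l x)
        + √(coeffMatrix h c x).det
          * ∑ i, fderiv ℝ (fieldCoord c l) x (EuclideanSpace.single i 1) i = 0)
    {u : H → ℝ} (hu : ContMDiff (𝓡 n) 𝓘(ℝ) 1 u) :
    ∫ p, dirDeriv l u p ∂(riemannianMeasure h) = 0 := by
  have := isFiniteMeasure_riemannianMeasure fun c => (hρ c).continuousOn
  let ψ : ∀ c : H, SmoothBumpFunction (𝓡 n) c := fun c => Classical.arbitrary _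
  obtain ⟨t, ht⟩ := CompactSpace.elim_nhds_subcover (fun c => Function.support (ψ c))
    fun c => (ψ c).support_mem_nhds
  have hψ : ∀ c, ContMDiff (𝓡 n) 𝓘(ℝ) 1 (ψ c) := fun c =>
    (contMDiff_smoothBumpFunction (ψ c)).of_le (by norm_num)
  -- Finitely many bump functions whose supports cover `H` have a positive sum `Ψ`. Dividing by it
  -- decomposes `u` into the pieces `ψ c * (u / Ψ)`, each supported in one chart domain.
  set Ψ : H → ℝ := fun p => ∑ c ∈ t, ψ c p with hΨdef
  have hΨ : ContMDiff (𝓡 n) 𝓘(ℝ) 1 Ψ := contMDiff_finsetSum fun c _ => hψ c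
  have hΨ0 : ∀ p, Ψ p ≠ 0 := by
    intro p
    have hp : p ∈ ⋃ c ∈ t, Function.support (ψ c) := by rw [ht]; trivial
    simp only [mem_iUnion, Function.mem_support] at hp
    obtain ⟨c, hc, hpc⟩ := hp
    exact (Finset.sum_pos' (fun c _ => (ψ c).nonneg)
      ⟨c, hc, lt_of_le_of_ne (ψ c).nonneg (Ne.symm hpc)⟩).ne'
  set v : H → H → ℝ := fun c p => ψ c p * (u p / Ψ p) with hv
  have hvC : ∀ c, ContMDiff (𝓡 n) 𝓘(ℝ) 1 (v c) := fun c => (hψ c).mul (hu.div₀ hΨ hΨ0)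
  have hv0 : ∀ c, ∫ p, dirDeriv l (v c) p ∂(riemannianMeasure h) = 0 := fun c =>
    integral_dirDeriv_eq_zero_of_tsupport_subset hl (hρ c) (hdiv c) (hvC c)
      (tsupport_mul_subset_left.trans (ψ c).tsupport_subset_extChartAt_source)
  have hint : ∀ w : H → ℝ, ContMDiff (𝓡 n) 𝓘(ℝ) 1 w →
      Integrable (dirDeriv l w) (riemannianMeasure h) := fun w hw =>
    (continuous_dirDeriv hl hw).integrable_of_hasCompactSupport (HasCompactSupport.of_compactSpace _)
  have hsum : ∀ s : Finset H,
      ∫ p, dirDeriv l (fun q => ∑ c ∈ s, v c q) p ∂(riemannianMeasure h) = 0 := by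
    intro s
    classical
    induction s using Finset.induction_on with
    | empty =>
      have : ∀ p, dirDeriv l (fun _ : H => (0 : ℝ)) p = 0 := fun p =>
        dirDeriv_eq_zero_of_notMem_tsupport (by simp [tsupport])
      simp [this]
    | insert c s hc ih =>
      have hs : ContMDiff (𝓡 n) 𝓘(ℝ) 1 fun q => ∑ c ∈ s, v c q :=
        contMDiff_finsetSum fun c _ => hvC c
      simp only [Finset.sum_insert hc, dirDeriv_add (hvC c) hs]
      rw [integral_add (hint _ (hvC c)) (hint _ hs), hv0, ih, add_zero]
  convert hsum t using 4
  funext p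
  simp only [hv, ← Finset.sum_mul]
  exact (mul_div_cancel₀ (u p) (hΨ0 p)).symm.trans (by ring)

end Divergence

/-! ### The surface gravity -/

section SurfaceGravity

variable {n : ℕ}
  {M : Type*} [TopologicalSpace M] [ChartedSpace (EuclideanSpace ℝ (Fin (n + 1))) M]
  [IsManifold (𝓡 (n + 1)) 4 M]
  {H : Type*} [TopologicalSpace H] [ChartedSpace (EuclideanSpace ℝ (Fin n)) H]
  [IsManifold (𝓡 n) 3 H]
  {g : Spacetime (n + 1) M} {ι : H → M} {l l' : ∀ p : H, TangentSpace (𝓡 n) p}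

theorem Spacetime.christoffelMap_smul (c : M) (x a b : EuclideanSpace ℝ (Fin (n + 1))) (r : ℝ) :
    g.christoffelMap c x a (r • b) = r • g.christoffelMap c x a b := by
  ext k
  simp only [christoffelMap, PiLp.smul_apply, smul_eq_mul, Finset.mul_sum]
  exact Finset.sum_congr rfl fun i _ => Finset.sum_congr rfl fun j _ => by ring

/-- The change of the surface gravity when the lightlike field is rescaled. -/
theorem IsHorizon.surfaceGravity_exp_smul (hι : IsHorizon g ι) (hl : IsLightlikeField g ι l)
    (hl' : IsLightlikeField g ι l') {f : H → ℝ} (hf : ∀ p, l' p = Real.exp (f p) • l p)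
    (hfC : ContMDiff (𝓡 n) 𝓘(ℝ) 1 f) (p : H) :
    surfaceGravity g ι l' p
      = dirDeriv l' f p + Real.exp (f p) * surfaceGravity g ι l p := by
  have hω := hι.isConnectionForm_connectionForm hl
  have hω' := hι.isConnectionForm_connectionForm hl'
  -- Points are written as images under the inverse chart, so that vectors given by `ofCoordVec`
  -- have the right base point.
  suffices key : ∀ (c : H) (x : EuclideanSpace ℝ (Fin n)), x ∈ (extChartAt (𝓡 n) c).target →
      surfaceGravity g ι l' ((extChartAt (𝓡 n) c).symm x)
        = dirDeriv l' f ((extChartAt (𝓡 n) c).symm x)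
          + Real.exp (f ((extChartAt (𝓡 n) c).symm x))
            * surfaceGravity g ι l ((extChartAt (𝓡 n) c).symm x) by
    have h := key p _ (mem_extChartAt_target p)
    rwa [extChartAt_to_inv] at h
  intro c x hx
  unfold surfaceGravity
  set ω := connectionForm g ι l
  set ω' := connectionForm g ι l'
  set p := (extChartAt (𝓡 n) c).symm x with hp
  have hsrc : ι p ∈ (extChartAt (𝓡 (n + 1)) (ι p)).source := mem_extChartAt_source (ι p)
  have hopen := (isOpen_extChartAt_target (I := 𝓡 n) c).mem_nhds hx
  set φ := localMap (n := n) ι c (ι p) with hφ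
  have hφC := contDiffAt_localMap hι.contMDiff hx hsrc
  set N := fun y => fderiv ℝ φ y (fieldCoord c l y) with hN
  obtain ⟨w, hw⟩ : ∃ w, w = fieldCoord c l' x := ⟨_, rfl⟩
  have hX : ofCoordVec c x w = l' p := by rw [hw, ofCoordVec_fieldCoord l' hx]
  have hNd : DifferentiableAt ℝ N x :=
    ((hφC.fderiv_right (m := 1) (by norm_num)).differentiableAt (by norm_num)).clm_apply
      (((contDiffOn_fieldCoord hl.contMDiff).contDiffAt hopen).differentiableAt (by norm_num))
  have hN0 : N x ≠ 0 := by
    intro h0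
    have h1 := coordVec_push hι.contMDiff hx hsrc (fieldCoord c l x)
    rw [ofCoordVec_fieldCoord l hx] at h1
    refine (hl.future p).1 (coordVec_injective (m := n + 1) hsrc ?_)
    rw [h1, coordVec_eq_coordMap, map_zero]
    exact h0
  have hfd : HasFDerivAt (fun y => f ((extChartAt (𝓡 n) c).symm y))
      (fderiv ℝ (fun y => f ((extChartAt (𝓡 n) c).symm y)) x) x :=
    ((hfC.contMDiffAt.comp x ((contMDiffAt_extChartAt_symm hx).of_le
      (by norm_num))).contDiffAt.differentiableAt (by norm_num)).hasFDerivAt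
  have hN' : (fun y => fderiv ℝ φ y (fieldCoord c l' y))
      = fun y => Real.exp (f ((extChartAt (𝓡 n) c).symm y)) • N y := by
    funext y
    rw [fieldCoord_smul hf, map_smul]
  have hexp : fderiv ℝ (fun y => Real.exp (f ((extChartAt (𝓡 n) c).symm y)) • N y) x = _ :=
    (hfd.exp.smul hNd.hasFDerivAt).fderiv
  have hNx : ∀ k : ∀ p : H, TangentSpace (𝓡 n) p,
      coordVec (ι p) (ι p) (push ι p (k p)) = fderiv ℝ φ x (fieldCoord c k x) := by
    intro k
    rw [← coordVec_push hι.contMDiff hx hsrc, ofCoordVec_fieldCoord k hx]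
  -- The derivatives of `l` and of `l' = e^f l`, both in the direction `l'`. The Leibniz rule and `N
  -- x ≠ 0` give `ω'(l') = ω(l') + l'(f)`, and `ω(l') = e^f ω(l)` by linearity.
  have e1 := coordVec_covDeriv (g := g) hι.contMDiff hl.contMDiff hx rfl w
  have e2 := coordVec_covDeriv (g := g) hι.contMDiff hl'.contMDiff hx rfl w
  rw [hX] at e1 e2
  rw [hω, coordVec_smul, hNx] at e1
  rw [hω', coordVec_smul, hNx, ← hp, ← hφ, hN', hexp,
    show fderiv ℝ φ x (fieldCoord c l' x) = Real.exp (f p) • N x from congrFun hN' x,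
    Spacetime.christoffelMap_smul] at e2
  have e3 : fderiv ℝ N x w + g.christoffelMap (ι p) (φ x) (fderiv ℝ φ x w) (N x)
      = ω p (l' p) • N x := e1.symm
  have e4 : (ω' p (l' p) * Real.exp (f p)) • N x
      = (Real.exp (f p) * (ω p (l' p) + dirDeriv l' f p)) • N x := by
    rw [mul_smul, e2, mul_add, add_smul, mul_smul, ← e3, dirDeriv_symm hx hfC, ← hw]
    simp only [add_apply, smul_apply, ContinuousLinearMap.smulRight_apply, smul_add, smul_eq_mul]
    abel
  have e5 := smul_left_injective ℝ hN0 e4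
  have e6 : ω p (l' p) = Real.exp (f p) * ω p (l p) := by
    rw [hf p, map_smul, smul_eq_mul]
  rw [← e6]
  refine mul_right_cancel₀ (Real.exp_ne_zero (f p)) ?_
  rw [e5]
  ring

/-- The normalisation `α(l') = 1` forces `α(l) = e^{-f}`, so `f = -log α(l)` inherits its regularity
from `α` and `l`. -/
theorem IsC1Form.contMDiff_of_exp_smul {α : ∀ p : H, TangentSpace (𝓡 n) p →L[ℝ] ℝ}
    (hα : IsC1Form α)
    (hl : ContMDiff (𝓡 n) (𝓡 n).tangent 1 fun p => (⟨p, l p⟩ : TangentBundle (𝓡 n) H))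
    {f : H → ℝ} (hf : ∀ p, l' p = Real.exp (f p) • l p) (hαl' : ∀ p, α p (l' p) = 1) :
    ContMDiff (𝓡 n) 𝓘(ℝ) 1 f := by
  have h1 : ∀ p, Real.exp (f p) * α p (l p) = 1 := fun p => by
    rw [← hαl' p, hf p, map_smul, smul_eq_mul]
  have h2 : ContMDiff (𝓡 n) 𝓘(ℝ) 1 fun p => α p (l p) := fun p =>
    contMDiffAt_linear_apply hα hl.contMDiffAt
  have h3 : f = fun p => -Real.log (α p (l p)) := by
    funext p
    have h4 : α p (l p) = Real.exp (-f p) := by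
      rw [Real.exp_neg]
      exact eq_inv_of_mul_eq_one_right (h1 p)
    rw [h4, Real.log_exp, neg_neg]
  rw [h3]
  intro p
  have h5 : α p (l p) ≠ 0 := right_ne_zero_of_mul_eq_one (h1 p)
  exact ContMDiffAt.comp (g := fun t : ℝ => -Real.log t) p
    ((Real.contDiffAt_log (n := 1)).2 h5).neg.contMDiffAt (h2 p)

end SurfaceGravity

end NullHorizon

end

/-! ### The sign of the constant surface gravity. -/

theorem mainTheorem5 {n : ℕ}
    {M : Type*} [TopologicalSpace M] [T2Space M] [ParacompactSpace M]
    [ChartedSpace (EuclideanSpace ℝ (Fin (n + 1))) M] [IsManifold (𝓡 (n + 1)) 4 M]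
    {H : Type*} [TopologicalSpace H] [CompactSpace H] [ConnectedSpace H]
    [ChartedSpace (EuclideanSpace ℝ (Fin n)) H] [IsManifold (𝓡 n) 3 H]
    [MeasurableSpace H] [BorelSpace H]
    (g : NullHorizon.Spacetime (n + 1) M) (ι : H → M) (hι : NullHorizon.IsHorizon g ι)
    (l l' : ∀ p : H, TangentSpace (𝓡 n) p)
    (hl : NullHorizon.IsLightlikeField g ι l) (hl' : NullHorizon.IsLightlikeField g ι l')
    (f : H → ℝ) (hf : ∀ p, l' p = Real.exp (f p) • l p)
    (κ : ℝ) (hκ : ∀ p, NullHorizon.surfaceGravity g ι l p = κ)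
    (α : ∀ p : H, TangentSpace (𝓡 n) p →L[ℝ] ℝ) (hα : NullHorizon.IsC1Form α)
    (hαl' : ∀ p, α p (l' p) = 1) :
    (∀ (p : H) (v : TangentSpace (𝓡 n) p), v ≠ 0 → 0 < NullHorizon.tildeMetric g ι α p v v) ∧
    Integrable (NullHorizon.surfaceGravity g ι l')
      (NullHorizon.riemannianMeasure (NullHorizon.tildeMetric g ι α)) ∧
    (κ < 0 ↔ ∫ p, NullHorizon.surfaceGravity g ι l' p
      ∂(NullHorizon.riemannianMeasure (NullHorizon.tildeMetric g ι α)) < 0) ∧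
    (κ = 0 ↔ ∫ p, NullHorizon.surfaceGravity g ι l' p
      ∂(NullHorizon.riemannianMeasure (NullHorizon.tildeMetric g ι α)) = 0) ∧
    (0 < κ ↔ 0 < ∫ p, NullHorizon.surfaceGravity g ι l' p
      ∂(NullHorizon.riemannianMeasure (NullHorizon.tildeMetric g ι α))) := by
  -- The bump functions of the divergence theorem need `H` Hausdorff, a property inherited from `M`
  -- through the embedding.
  have : T2Space H := hι.isEmbedding.t2Space
  set μ := NullHorizon.riemannianMeasure (NullHorizon.tildeMetric g ι α)
  have hpos := hι.tildeMetric_pos hl' hαl'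
  have hdet : ∀ c : H, ∀ x ∈ (extChartAt (𝓡 n) c).target,
      0 < (NullHorizon.coeffMatrix (NullHorizon.tildeMetric g ι α) c x).det := fun c x hx =>
    NullHorizon.det_coeffMatrix_pos (NullHorizon.tildeMetric_symm α) hpos hx
  have hρ : ∀ c, ContDiffOn ℝ 1
      (fun x => √(NullHorizon.coeffMatrix (NullHorizon.tildeMetric g ι α) c x).det)
      (extChartAt (𝓡 n) c).target := fun c =>
    NullHorizon.contDiffOn_sqrt_det (hι.contDiffOn_coeffMatrix_tildeMetric hα c) (hdet c)
  have : IsFiniteMeasure μ :=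
    NullHorizon.isFiniteMeasure_riemannianMeasure fun c => (hρ c).continuousOn
  have hμ : μ ≠ 0 :=
    NullHorizon.riemannianMeasure_ne_zero hdet fun c => (hρ c).continuousOn
  have hfC := hα.contMDiff_of_exp_smul hl.contMDiff hf hαl'
  have hκ' : NullHorizon.surfaceGravity g ι l'
      = fun p => NullHorizon.dirDeriv l' f p + Real.exp (f p) * κ := by
    funext p
    rw [hι.surfaceGravity_exp_smul hl hl' hf hfC, hκ]
  have hi1 : Integrable (NullHorizon.dirDeriv l' f) μ :=
    (NullHorizon.continuous_dirDeriv hl'.contMDiff hfC).integrable_of_hasCompactSupport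
      (HasCompactSupport.of_compactSpace _)
  have hexp : Continuous fun p => Real.exp (f p) := Real.continuous_exp.comp hfC.continuous
  have hi2 : Integrable (fun p => Real.exp (f p)) μ :=
    hexp.integrable_of_hasCompactSupport (HasCompactSupport.of_compactSpace _)
  have hzero : ∫ p, NullHorizon.dirDeriv l' f p ∂μ = 0 :=
    NullHorizon.integral_dirDeriv_eq_zero hl'.contMDiff hρ
      (fun c x hx => hι.divergence_eq_zero hl' hα hαl' hx) hfC
  have hI : 0 < ∫ p, Real.exp (f p) ∂μ := by
    have : NeZero μ := ⟨hμ⟩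
    exact integral_exp_pos hi2
  -- The exact derivative drops out, leaving `κ` times a positive number; the three sign statements
  -- follow from this identity.
  have hint : ∫ p, NullHorizon.surfaceGravity g ι l' p ∂μ = (∫ p, Real.exp (f p) ∂μ) * κ := by
    rw [hκ', integral_add hi1 (hi2.mul_const κ), hzero, zero_add, integral_mul_const]
  refine ⟨hpos, ?_, ?_, ?_, ?_⟩
  · rw [hκ']
    exact hi1.add (hi2.mul_const κ)
  · rw [hint, ← smul_eq_mul, smul_neg_iff_of_pos_left hI]
  · rw [hint, mul_eq_zero, or_iff_right hI.ne']
  · rw [hint, mul_pos_iff_of_pos_left hI]
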